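/- Let $f_1,\dots,f_N$ be similarities of $\mathbb R^d$ with contraction ratios $\lambda_1,\dots,\lambda_N\in(0,1)$, satisfying the open set condition: there is a nonempty bounded open set $U\subset\mathbb R^d$ with $f_i(U)\subset U$ for all $i$ and $f_i(U)\cap f_j(U)=\emptyset$ for $i\neq j$. Let $\Lambda$ be the attractor, i.e. the nonempty compact set with $\Lambda=\bigcup_i f_i(\Lambda)$, let $s_0=\dim_H\Lambda$, and let $\mathcal H^{s_0}$ be the $s_0$-dimensional Hausdorff measure. Let $\Sigma=\{1,\dots,N\}^{\mathbb N}$, let $\sigma$ be the left shift on $\Sigma$, write $\bar\imath|_n$ for the word of the first $n$ letters of $\bar\imath\in\Sigma$ and $[w]$ for the set of all sequences in $\Sigma$ that begin with the finite word $w$, and let $\pi(\bar\imath)=\lim_{n\to\infty} f_{i_1}\circ\cdots\circ f_{i_n}(0)$. For $\bar o\in\Sigma$ and $\ell:\mathbb N\to\mathbb N$ put $$R(\bar o,\ell)=\pi\big(\{\bar\imath\in\Sigma:\ \bar\imath\in[(\sigma^n\bar o)|_{\ell(n)}]\text{ for infinitely many }n\}\big).$$ Let $p=(p_1,\dots,p_N)$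 be a probability vector with all $p_i>0$, let $p_{\min}=\min_i p_i$, and let $\mathbb P_p$ be the corresponding Bernoulli (product) measure on $\Sigma$. Let $\alpha>0$ and let $\ell:\mathbb N\to\mathbb N$ be monotone (non-strictly) increasing with $$\liminf_{n\to\infty}\frac{\ell(n)}{\log n}=\frac1\alpha .$$ Then for every $q\in\mathbb R$ there is a unique real number $P_\alpha(q)$ with $\sum_{i=1}^N\lambda_i^{P_\alpha(q)}(p_ie^\alpha)^q=1$, the infimum $\inf_{q\in[0,1]}P_\alpha(q)$ is finite and non-negative, and for $\mathbb P_p$-almost every $\bar o\in\Sigma$: 1. $\dim_H R(\bar o,\ell)=\inf_{q\in[0,1]}P_\alpha(q)$; 2. if $-\log p_{\min}>\alpha>-\sum_{i=1}^N\lambda_i^{s_0}\log p_i$, then $\mathcal H^{s_0}(R(\bar o,\ell))=\mathcal H^{s_0}(\Lambda)$ but $R(\bar o,\ell)\neq\Lambda$; 3. if $\alpha>-\log p_{\min}$, then $R(\bar o,\ell)=\Lambda$. -/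

import Mathlib

open Set Filter Topology MeasureTheory

noncomputable section

/-- An iterated function system of `N` contracting similarities on `ℝ^d`, together with its
contraction ratios. -/
structure SimilarityIFS (d N : ℕ) where
  /-- the maps `f_1, …, f_N` -/
  map : Fin N → EuclideanSpace ℝ (Fin d) → EuclideanSpace ℝ (Fin d)
  /-- the contraction ratios `λ_1, …, λ_N` -/
  ratio : Fin N → ℝ
  ratio_pos : ∀ i, 0 < ratio i
  ratio_lt_one : ∀ i, ratio i < 1
  dist_map : ∀ i x y, dist (map i x) (map i y) = ratio i * dist x y

namespace SimilarityIFS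

variable {d N : ℕ}

/-- The open set condition. The open set has to be nonempty. -/
def OpenSetCondition (F : SimilarityIFS d N) : Prop :=
  ∃ U : Set (EuclideanSpace ℝ (Fin d)), IsOpen U ∧ Bornology.IsBounded U ∧ U.Nonempty ∧
    (∀ i, F.map i '' U ⊆ U) ∧ ∀ i j, i ≠ j → Disjoint (F.map i '' U) (F.map j '' U)

/-- `L` is the attractor (the self-similar set) of `F`: the nonempty compact set with
`L = ⋃ i, f_i(L)`. -/
def IsAttractor (F : SimilarityIFS d N) (L : Set (EuclideanSpace ℝ (Fin d))) : Prop :=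
  IsCompact L ∧ L.Nonempty ∧ L = ⋃ i, F.map i '' L

/-- `F.wordMap ω n = f_{ω 0} ∘ ⋯ ∘ f_{ω (n - 1)}`, the map of the prefix of length `n` of `ω`. -/
def wordMap (F : SimilarityIFS d N) (ω : ℕ → Fin N) :
    ℕ → EuclideanSpace ℝ (Fin d) → EuclideanSpace ℝ (Fin d)
  | 0 => id
  | n + 1 => F.wordMap ω n ∘ F.map (ω n)

/-- The coding map `π(ω) = lim_n f_{ω|n}(0)`. The limit always exists. -/
def coding (F : SimilarityIFS d N) (ω : ℕ → Fin N) : EuclideanSpace ℝ (Fin d) :=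
  limUnder atTop (fun n => F.wordMap ω n 0)

end SimilarityIFS

/-- The left shift on the symbolic space. -/
def leftShift {N : ℕ} (ω : ℕ → Fin N) : ℕ → Fin N := fun k => ω (k + 1)

/-- The dynamical covering set `R(o, ℓ)`: the projection of the set of all sequences that lie in
the cylinder `[(σ^n o)|_{ℓ(n)}]` for infinitely many `n`. -/
def SimilarityIFS.coveringSet {d N : ℕ} (F : SimilarityIFS d N) (o : ℕ → Fin N) (ℓ : ℕ → ℕ) :
    Set (EuclideanSpace ℝ (Fin d)) :=
  F.coding '' {ω | ∃ᶠ n in atTop, ω ∈ PiNat.cylinder (leftShift^[n] o) (ℓ n)}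

/-- The measure on the alphabet that gives mass `p i` to the letter `i`. -/
def letterMeasure {N : ℕ} (p : Fin N → ℝ) : Measure (Fin N) :=
  ∑ i, ENNReal.ofReal (p i) • Measure.dirac i

theorem isProbabilityMeasure_letterMeasure {N : ℕ} (p : Fin N → ℝ) (hp : ∀ i, 0 ≤ p i)
    (hsum : ∑ i, p i = 1) : IsProbabilityMeasure (letterMeasure p) := by
  constructor
  simp [letterMeasure, ← ENNReal.ofReal_sum_of_nonneg (fun i _ => hp i), hsum]

/-- The Bernoulli measure on the symbolic space of a probability vector `p`: the product of
countably many copies of `letterMeasure p`. -/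
def bernoulliMeasure {N : ℕ} (p : Fin N → ℝ) : Measure (ℕ → Fin N) :=
  Measure.infinitePi (fun _ => letterMeasure p)

end

/-!
Let `u_i = p_i exp α`. A word `w` of length `L` enters the covering set only through its occurrences
in `o` before time about `exp (α L)`: `ℓ n = L` forces `n ≤ exp (α L)`, up to small errors, and the
inferior limit is approached along infinitely many `n`, for which, `ℓ` being monotone, the words
occurring before `n` count as well.

*Upper bound.* `w` occurs that early with probability at most `min 1 (exp (α L) p_w)`, hence at most
`∏ u_{w_i} ^ q` for `q ∈ [0, 1]`. The expected `t`-dimensional size of the cover by the words of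
length `L` is therefore at most a constant times `(∑ λ_i ^ t u_i ^ q) ^ L`, which is summable for
`t > P q` (`SimilarityIFS.ae_hausdorffMeasure_coveringSet_eq_zero`).

*Occurrence of words.* Until time `exp (α L)` there are about `exp (α L) / L` independent blocks, so
that exponentially many sets of words, each of `p`-mass at least `exp (-γ L)` with `γ < α`, are all
visited with a probability superexponentially close to `1`
(`ae_frequently_forall_exists_subword_mem`). This one lemma, applied to different families of sets
of words, gives all lower bounds. For singletons it shows that every sequence with averages of
`-log p` below `α` is in the limsup set; that is all of them if `α > -log p_min`, and all but a
`μH[s₀]`-null set, by a Chernoff bound, if `α` exceeds the `λ ^ s₀`-average of `-log p`.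

*Lower bound.* Let `q` minimise `P` on `[0, 1]`, let `s = P q` and `ρ_i = λ_i ^ s u_i ^ q`. The first
order condition says that the entropy `h` and the Lyapunov exponent `χ` of `ρ` satisfy
`h = s χ + (β - α)⁺` with `β = -∑ ρ_i log p_i` (`entropy_eq_of_isMinOn_pressure`). Applied to the sets
of extensions of a given prefix of length `(1 - κ) L`, `κ = (β - α)⁺ / h`, the occurrence lemma shows
that every `ρ`-typical prefix has an extension of length `L` that occurs in time and has typical
contraction. Overwriting sequences by these extensions at sparse lengths `L` sends the Bernoulli
measure of `ρ` to a measure on the limsup set of local dimension `(1 - κ) h / χ = s` at the scales of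
the lengths `L`, and larger in between
(`SimilarityIFS.OpenSetCondition.le_dimH_coding_image_of_extension`). The open set condition
transfers the estimate to the Euclidean space: a set of diameter `r` meets boundedly many cylinders
of size `r` (`SimilarityIFS.OpenSetCondition.exists_cover`).

*Proper inclusion.* If `α < -log p_i`, then long runs of the letter `i` come too late, by
Borel–Cantelli. The open set condition makes the set of codings of the fixed point of `f_i` finite;
prefixing `i` is an injection of this set into itself, hence a bijection, so that the constant
sequence is its only element, and the fixed point is not covered
(`SimilarityIFS.OpenSetCondition.ae_coveringSet_ne`).
-/

/-! ### Similarities, prefixes and the coding map -/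

namespace SimilarityIFS

variable {d N : ℕ} (F : SimilarityIFS d N)

theorem wordMap_congr {ω ω' : ℕ → Fin N} {n : ℕ} (h : ω' ∈ PiNat.cylinder ω n) :
    F.wordMap ω' n = F.wordMap ω n := by
  induction n with
  | zero => rfl
  | succ n ih =>
    have h1 : ω' n = ω n := h n (Nat.lt_succ_self n)
    simp only [wordMap, h1, ih (PiNat.cylinder_anti ω (Nat.le_succ n) h)]

theorem dist_wordMap (ω : ℕ → Fin N) (n : ℕ) (x y : EuclideanSpace ℝ (Fin d)) :
    dist (F.wordMap ω n x) (F.wordMap ω n y) =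
      (∏ i ∈ Finset.range n, F.ratio (ω i)) * dist x y := by
  induction n generalizing x y with
  | zero => simp [wordMap]
  | succ n ih =>
    simp only [wordMap, Function.comp_apply, ih, F.dist_map, Finset.prod_range_succ]
    ring

theorem wordMap_add (ω : ℕ → Fin N) (n m : ℕ) :
    F.wordMap ω (n + m) = F.wordMap ω n ∘ F.wordMap (fun k => ω (n + k)) m := by
  induction m with
  | zero => rfl
  | succ m ih => rw [← add_assoc, wordMap, ih, wordMap, Function.comp_assoc]

theorem prod_ratio_pos (ω : ℕ → Fin N) (n : ℕ) : 0 < ∏ i ∈ Finset.range n, F.ratio (ω i) :=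
  Finset.prod_pos fun _ _ => F.ratio_pos _

theorem prod_ratio_anti (ω : ℕ → Fin N) {m n : ℕ} (h : m ≤ n) :
    ∏ i ∈ Finset.range n, F.ratio (ω i) ≤ ∏ i ∈ Finset.range m, F.ratio (ω i) :=
  antitone_nat_of_succ_le (f := fun n => ∏ i ∈ Finset.range n, F.ratio (ω i)) (fun n => by
    rw [Finset.prod_range_succ]
    exact mul_le_of_le_one_right (F.prod_ratio_pos ω n).le (F.ratio_lt_one _).le) h

theorem prod_ratio_congr {ω ω' : ℕ → Fin N} {n : ℕ} (h : ω' ∈ PiNat.cylinder ω n) :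
    ∏ i ∈ Finset.range n, F.ratio (ω' i) = ∏ i ∈ Finset.range n, F.ratio (ω i) :=
  Finset.prod_congr rfl fun i hi => by rw [h i (Finset.mem_range.1 hi)]

theorem exists_ratio_bounds :
    ∃ a b : ℝ, 0 < a ∧ a ≤ 1 ∧ 0 ≤ b ∧ b < 1 ∧ ∀ i, a ≤ F.ratio i ∧ F.ratio i ≤ b := by
  rcases isEmpty_or_nonempty (Fin N) with h | h
  · exact ⟨1, 0, one_pos, le_rfl, le_rfl, one_pos, fun i => h.elim i⟩
  · obtain ⟨i, hi⟩ := Finite.exists_min F.ratio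
    obtain ⟨j, hj⟩ := Finite.exists_max F.ratio
    exact ⟨F.ratio i, F.ratio j, F.ratio_pos i, (F.ratio_lt_one i).le, (F.ratio_pos j).le,
      F.ratio_lt_one j, fun k => ⟨hi k, hj k⟩⟩

theorem tendsto_prod_ratio (ω : ℕ → Fin N) :
    Tendsto (fun n => ∏ i ∈ Finset.range n, F.ratio (ω i)) atTop (𝓝 0) := by
  obtain ⟨a, b, -, -, hb0, hb1, hab⟩ := F.exists_ratio_bounds
  refine squeeze_zero (fun n => (F.prod_ratio_pos ω n).le) (fun n => ?_)
    (tendsto_pow_atTop_nhds_zero_of_lt_one hb0 hb1)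
  calc ∏ i ∈ Finset.range n, F.ratio (ω i) ≤ ∏ i ∈ Finset.range n, b :=
        Finset.prod_le_prod (fun _ _ => (F.ratio_pos _).le) fun _ _ => (hab _).2
    _ = b ^ n := by simp

/-- The approximations `f_{ω|n}(0)` converge geometrically, uniformly in `ω`. -/
theorem exists_geometric_bound :
    ∃ b C : ℝ, 0 ≤ b ∧ b < 1 ∧ 0 ≤ C ∧ ∀ (ω : ℕ → Fin N) n,
      dist (F.wordMap ω n 0) (F.wordMap ω (n + 1) 0) ≤ C * b ^ n := by
  obtain ⟨a, b, -, -, hb0, hb1, hab⟩ := F.exists_ratio_bounds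
  refine ⟨b, ∑ i, dist 0 (F.map i 0), hb0, hb1, Finset.sum_nonneg fun _ _ => dist_nonneg,
    fun ω n => ?_⟩
  rw [wordMap, Function.comp_apply, dist_wordMap, mul_comm]
  have h1 : ∏ i ∈ Finset.range n, F.ratio (ω i) ≤ b ^ n := by
    calc _ ≤ ∏ i ∈ Finset.range n, b :=
        Finset.prod_le_prod (fun _ _ => (F.ratio_pos _).le) fun _ _ => (hab _).2
      _ = b ^ n := by simp
  have h2 : dist 0 (F.map (ω n) 0) ≤ ∑ i, dist 0 (F.map i 0) :=
    Finset.single_le_sum (f := fun i => dist 0 (F.map i 0)) (fun _ _ => dist_nonneg)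
      (Finset.mem_univ (ω n))
  exact mul_le_mul h2 h1 (F.prod_ratio_pos ω n).le (dist_nonneg.trans h2)

theorem tendsto_coding (ω : ℕ → Fin N) :
    Tendsto (fun n => F.wordMap ω n 0) atTop (𝓝 (F.coding ω)) := by
  obtain ⟨b, C, -, hb1, -, h⟩ := F.exists_geometric_bound
  exact (cauchySeq_tendsto_of_complete (cauchySeq_of_le_geometric b C hb1 (h ω))).elim
    fun _ hx => tendsto_nhds_limUnder ⟨_, hx⟩

theorem exists_dist_coding_le :
    ∃ D : ℝ, 0 < D ∧ ∀ ω ω' : ℕ → Fin N, dist (F.coding ω) (F.coding ω') ≤ D := by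
  obtain ⟨b, C, hb0, hb1, hC, h⟩ := F.exists_geometric_bound
  have hb2 : 0 < 1 - b := sub_pos.2 hb1
  refine ⟨C / (1 - b) + C / (1 - b) + 1, by positivity, fun ω ω' => ?_⟩
  have h0 := fun ω => dist_le_of_le_geometric_of_tendsto₀ b C hb1 (h ω) (F.tendsto_coding ω)
  have h1 := h0 ω
  have h2 := h0 ω'
  simp only [wordMap, id] at h1 h2
  linarith [dist_triangle_left (F.coding ω) (F.coding ω') 0]

theorem continuous_wordMap (ω : ℕ → Fin N) (n : ℕ) : Continuous (F.wordMap ω n) := by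
  refine (LipschitzWith.of_dist_le_mul (K := ⟨_, (F.prod_ratio_pos ω n).le⟩) fun x y => ?_).continuous
  rw [dist_wordMap]; rfl

theorem injective_wordMap (ω : ℕ → Fin N) (n : ℕ) : Function.Injective (F.wordMap ω n) := by
  intro x y hxy
  have := F.dist_wordMap ω n x y
  rw [hxy, dist_self, eq_comm, mul_eq_zero] at this
  exact dist_eq_zero.1 (this.resolve_left (F.prod_ratio_pos ω n).ne')

theorem coding_eq_wordMap (ω : ℕ → Fin N) (n : ℕ) :
    F.coding ω = F.wordMap ω n (F.coding fun k => ω (n + k)) := by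
  have h1 := ((F.continuous_wordMap ω n).tendsto _).comp (F.tendsto_coding fun k => ω (n + k))
  have h2 := (F.tendsto_coding ω).comp (tendsto_add_atTop_nat n)
  refine tendsto_nhds_unique h2 (h1.congr fun m => ?_)
  rw [Function.comp_apply, Function.comp_apply, add_comm m n, wordMap_add, Function.comp_apply]

theorem dist_coding_le_of_mem_cylinder {D : ℝ}
    (hD : ∀ ω ω' : ℕ → Fin N, dist (F.coding ω) (F.coding ω') ≤ D) {ω ω' : ℕ → Fin N} {n : ℕ}
    (h : ω' ∈ PiNat.cylinder ω n) :
    dist (F.coding ω) (F.coding ω') ≤ (∏ i ∈ Finset.range n, F.ratio (ω i)) * D := by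
  rw [F.coding_eq_wordMap ω n, F.coding_eq_wordMap ω' n, F.wordMap_congr h, dist_wordMap]
  exact mul_le_mul_of_nonneg_left (hD _ _) (F.prod_ratio_pos ω n).le

theorem measurable_coding : Measurable F.coding := by
  refine measurable_of_tendsto_metrizable (f := fun n ω => F.wordMap ω n 0) (fun n => ?_)
    (tendsto_pi_nhds.2 F.tendsto_coding)
  rcases isEmpty_or_nonempty (Fin N) with h | ⟨⟨i₀⟩⟩
  · have : IsEmpty (ℕ → Fin N) := ⟨fun ω => h.elim (ω 0)⟩
    exact measurable_of_empty _
  -- the map factors through the first `n` letters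
  have h : (fun ω : ℕ → Fin N => F.wordMap ω n 0) =
      (fun w : Fin n → Fin N => F.wordMap (fun k => if h : k < n then w ⟨k, h⟩ else i₀) n 0) ∘
        fun ω i => ω i := by
    funext ω
    simp only [Function.comp_apply]
    refine congrFun (F.wordMap_congr fun k hk => ?_) 0
    simp [hk]
  rw [h]
  exact (measurable_of_finite _).comp (by fun_prop)

theorem IsAttractor.eq_range_coding {F : SimilarityIFS d N} {L : Set (EuclideanSpace ℝ (Fin d))}
    (hL : F.IsAttractor L) : L = range F.coding := by
  obtain ⟨hc, ⟨z, hz⟩, he⟩ := hL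
  have hinv : ∀ i, ∀ x ∈ L, F.map i x ∈ L := fun i x hx => by
    rw [he]; exact mem_iUnion.2 ⟨i, x, hx, rfl⟩
  apply Subset.antisymm
  · intro x hx
    have hpre : ∀ y : L, ∃ (i : Fin N) (y' : L), F.map i y' = y := by
      rintro ⟨y, hy⟩
      rw [he] at hy
      obtain ⟨i, y', hy', h⟩ := mem_iUnion.1 hy
      exact ⟨i, ⟨y', hy'⟩, h⟩
    choose I Y hY using hpre
    let y : ℕ → L := fun n => Y^[n] ⟨x, hx⟩
    have hxy : ∀ n, F.wordMap (fun k => I (y k)) n (y n) = x := by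
      intro n
      induction n with
      | zero => rfl
      | succ n ih =>
        rw [wordMap, Function.comp_apply]
        have : F.map (I (y n)) (y (n + 1)) = y n := by
          simp only [y, Function.iterate_succ_apply', hY]
        rw [this, ih]
    refine ⟨fun k => I (y k), tendsto_nhds_unique (F.tendsto_coding _) ?_⟩
    obtain ⟨R, hR⟩ := hc.isBounded.exists_norm_le
    rw [tendsto_iff_dist_tendsto_zero]
    refine squeeze_zero (fun _ => dist_nonneg) (fun n => ?_)
      (by simpa using (F.tendsto_prod_ratio fun k => I (y k)).mul_const R)
    conv_lhs => rw [← hxy n]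
    rw [dist_wordMap, dist_zero_left]
    exact mul_le_mul_of_nonneg_left (hR _ (y n).2) (F.prod_ratio_pos _ n).le
  · rintro _ ⟨ω, rfl⟩
    have hw : ∀ n, ∀ x ∈ L, F.wordMap ω n x ∈ L := by
      intro n
      induction n with
      | zero => exact fun x hx => hx
      | succ n ih => exact fun x hx => ih _ (hinv _ _ hx)
    have ht : Tendsto (fun n => F.wordMap ω n z) atTop (𝓝 (F.coding ω)) := by
      refine (F.tendsto_coding ω).congr_dist ?_
      simpa only [dist_wordMap, zero_mul] using (F.tendsto_prod_ratio ω).mul_const (dist 0 z)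
    exact hc.isClosed.mem_of_tendsto ht (Eventually.of_forall fun n => hw n z hz)

/-! ### Counting cylinders under the open set condition -/

theorem surjective_map (i : Fin N) : Function.Surjective (F.map i) := by
  have hpos := F.ratio_pos i
  have hi : Isometry fun x => (F.ratio i)⁻¹ • F.map i x := by
    refine Isometry.of_dist_eq fun x y => ?_
    rw [dist_smul₀, F.dist_map, Real.norm_of_nonneg (inv_pos.2 hpos).le,
      inv_mul_cancel_left₀ hpos.ne']
  let A := hi.affineIsometryOfStrictConvexSpace
  have hlin : Function.Surjective A.linear :=
    (LinearMap.injective_iff_surjective (f := A.linear)).1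
      ((AffineMap.linear_injective_iff A.toAffineMap).2 hi.injective)
  have hA : Function.Surjective A.toAffineMap :=
    (AffineMap.linear_surjective_iff A.toAffineMap).1 hlin
  intro y
  obtain ⟨x, hx⟩ := hA ((F.ratio i)⁻¹ • y)
  exact ⟨x, smul_right_injective _ (inv_pos.2 hpos).ne' hx⟩

theorem surjective_wordMap (ω : ℕ → Fin N) (n : ℕ) : Function.Surjective (F.wordMap ω n) := by
  induction n with
  | zero => exact Function.surjective_id
  | succ n ih => exact ih.comp (F.surjective_map _)

theorem wordMap_image_subset {U : Set (EuclideanSpace ℝ (Fin d))}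
    (hU : ∀ i, F.map i '' U ⊆ U) (ω : ℕ → Fin N) (n : ℕ) : F.wordMap ω n '' U ⊆ U := by
  induction n with
  | zero => simp [wordMap]
  | succ n ih => rw [wordMap, image_comp]; exact (image_mono (hU _)).trans ih

/-- Images of the open set under incomparable words are disjoint. -/
theorem disjoint_wordMap_image {U : Set (EuclideanSpace ℝ (Fin d))}
    (hU : ∀ i, F.map i '' U ⊆ U) (hdisj : ∀ i j, i ≠ j → Disjoint (F.map i '' U) (F.map j '' U))
    {ω ω' : ℕ → Fin N} {m n : ℕ} (h1 : ω' ∉ PiNat.cylinder ω m) (h2 : ω ∉ PiNat.cylinder ω' n) :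
    Disjoint (F.wordMap ω m '' U) (F.wordMap ω' n '' U) := by
  have hne : ω' ≠ ω := fun h => h1 (h ▸ PiNat.self_mem_cylinder ω m)
  rw [PiNat.mem_cylinder_iff_le_firstDiff hne, not_le] at h1
  rw [PiNat.mem_cylinder_iff_le_firstDiff hne.symm, not_le, PiNat.firstDiff_comm] at h2
  set k := PiNat.firstDiff ω' ω
  have hsub : ∀ (ω : ℕ → Fin N) (m : ℕ), k < m →
      F.wordMap ω m '' U ⊆ F.wordMap ω k '' (F.map (ω k) '' U) := by
    intro ω m hm
    obtain ⟨j, rfl⟩ := Nat.exists_eq_add_of_le (Nat.succ_le_of_lt hm)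
    rw [wordMap_add, image_comp, ← image_comp (F.wordMap ω k)]
    exact image_mono (F.wordMap_image_subset hU _ _)
  refine Disjoint.mono (hsub ω m h1) (hsub ω' n h2) ?_
  rw [F.wordMap_congr (PiNat.mem_cylinder_firstDiff ω' ω)]
  exact (disjoint_image_iff (F.injective_wordMap ω k)).2
    (hdisj _ _ (PiNat.apply_firstDiff_ne hne).symm)

/-- Under the open set condition a set of diameter `r` meets boundedly many pairwise incomparable
cylinders of size comparable to `r`: the corresponding copies of the open set are disjoint and
each contains a ball of radius comparable to `r`, near the given set. -/
theorem OpenSetCondition.exists_card_le {F : SimilarityIFS d N} (hF : F.OpenSetCondition)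
    {a : ℝ} (ha : 0 < a) :
    ∃ M : ℕ, ∀ (r : ℝ), 0 < r → ∀ (τ : (ℕ → Fin N) → ℕ) (I : Finset (ℕ → Fin N)),
      (∀ ω ∈ I, ∏ i ∈ Finset.range (τ ω), F.ratio (ω i) ≤ r) →
      (∀ ω ∈ I, a * r ≤ ∏ i ∈ Finset.range (τ ω), F.ratio (ω i)) →
      (∀ ω ∈ I, ∀ ω' ∈ I, dist (F.coding ω) (F.coding ω') ≤ r) →
      (∀ ω ∈ I, ∀ ω' ∈ I, ω ≠ ω' → ω' ∉ PiNat.cylinder ω (τ ω)) → I.card ≤ M := by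
  obtain ⟨U, hUo, -, ⟨x₀, hx₀⟩, hU, hdisj⟩ := hF
  obtain ⟨D, hD, hcod⟩ := F.exists_dist_coding_le
  obtain ⟨c, hc, hcU⟩ := Metric.isOpen_iff.1 hUo x₀ hx₀
  have hfin : ∃ D' : ℝ, 0 < D' ∧ ∀ ω : ℕ → Fin N, dist x₀ (F.coding ω) ≤ D' := by
    rcases isEmpty_or_nonempty (ℕ → Fin N) with h | ⟨⟨ω₀⟩⟩
    · exact ⟨1, one_pos, fun ω => h.elim ω⟩
    · exact ⟨dist x₀ (F.coding ω₀) + D, by positivity, fun ω =>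
        (dist_triangle _ (F.coding ω₀) _).trans (by gcongr; exact hcod _ _)⟩
  obtain ⟨D', hD', hx₀D⟩ := hfin
  let E := EuclideanSpace ℝ (Fin d)
  let v : ENNReal := volume (Metric.ball (0 : E) 1)
  have hv0 : v ≠ 0 := (Metric.measure_ball_pos volume (0 : E) one_pos).ne'
  have hvt : v ≠ ⊤ := measure_ball_lt_top.ne
  have hball : ∀ (x : E) (ρ : ℝ), 0 < ρ → volume (Metric.ball x ρ) = ENNReal.ofReal (ρ ^ d) * v := by
    intro x ρ hρ
    rw [Measure.addHaar_ball_of_pos volume x hρ, finrank_euclideanSpace_fin]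
  refine ⟨⌈((1 + D' + c) / (c * a)) ^ d⌉₊, fun r hr τ I hle hge hdist hinc => ?_⟩
  rcases I.eq_empty_or_nonempty with rfl | ⟨ω₁, hω₁⟩
  · simp
  let B : (ℕ → Fin N) → Set E := fun ω => Metric.ball (F.wordMap ω (τ ω) x₀) (c * (a * r))
  have hBU : ∀ ω ∈ I, B ω ⊆ F.wordMap ω (τ ω) '' U := by
    intro ω hω y hy
    obtain ⟨z, rfl⟩ := F.surjective_wordMap ω (τ ω) y
    refine ⟨z, hcU ?_, rfl⟩
    have hy' : (∏ i ∈ Finset.range (τ ω), F.ratio (ω i)) * dist z x₀ < c * (a * r) := by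
      rw [← dist_wordMap]; exact hy
    have h1 := hge ω hω
    have har : 0 < a * r := by positivity
    rw [Metric.mem_ball]
    by_contra! hcon
    have := mul_le_mul h1 hcon hc.le (F.prod_ratio_pos _ _).le
    linarith
  have hBd : (I : Set (ℕ → Fin N)).PairwiseDisjoint B := by
    intro ω hω ω' hω' hne
    exact (F.disjoint_wordMap_image hU hdisj (hinc ω hω ω' hω' hne)
      (hinc ω' hω' ω hω hne.symm)).mono (hBU ω hω) (hBU ω' hω')
  have hBsub : (⋃ ω ∈ I, B ω) ⊆ Metric.ball (F.coding ω₁) ((1 + D' + c) * r) := by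
    intro y hy
    obtain ⟨ω, hω, hy⟩ := mem_iUnion₂.1 hy
    have h1 : dist (F.wordMap ω (τ ω) x₀) (F.coding ω) ≤ r * D' := by
      rw [F.coding_eq_wordMap ω (τ ω), dist_wordMap]
      exact mul_le_mul (hle ω hω) (hx₀D _) dist_nonneg hr.le
    have h2 := hdist ω hω ω₁ hω₁
    have h3 : dist y (F.wordMap ω (τ ω) x₀) < c * (a * r) := hy
    have h4 : a * r ≤ r := (hge ω hω).trans (hle ω hω)
    have h5 : c * (a * r) ≤ c * r := mul_le_mul_of_nonneg_left h4 hc.le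
    rw [Metric.mem_ball]
    calc dist y (F.coding ω₁) ≤ dist y (F.wordMap ω (τ ω) x₀) +
          dist (F.wordMap ω (τ ω) x₀) (F.coding ω) + dist (F.coding ω) (F.coding ω₁) :=
          dist_triangle4 _ _ _ _
      _ < (1 + D' + c) * r := by nlinarith
  have hmeas := measure_mono (μ := volume) hBsub
  rw [measure_biUnion_finset hBd fun _ _ => measurableSet_ball,
    Finset.sum_congr rfl fun ω _ => hball _ _ (by positivity : 0 < c * (a * r)),
    hball _ _ (by positivity), Finset.sum_const, nsmul_eq_mul, ← mul_assoc,
    ENNReal.mul_le_mul_iff_left hv0 hvt, ← ENNReal.ofReal_natCast,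
    ← ENNReal.ofReal_mul (by positivity), ENNReal.ofReal_le_ofReal_iff (by positivity)] at hmeas
  have hq : (I.card : ℝ) ≤ ((1 + D' + c) / (c * a)) ^ d := by
    rw [div_pow, le_div_iff₀ (by positivity)]
    have hrd : 0 < r ^ d := by positivity
    rw [← mul_assoc, mul_pow _ r, mul_pow _ r, ← mul_assoc] at hmeas
    exact le_of_mul_le_mul_right hmeas hrd
  exact_mod_cast hq.trans (Nat.le_ceil _)

end SimilarityIFS

namespace SimilarityIFS

variable {d N : ℕ} (F : SimilarityIFS d N)

/-- The first time at which the cylinders around `ω` are contracted by at least the factor `r`. -/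
noncomputable def scaleTime (F : SimilarityIFS d N) (r : ℝ) (ω : ℕ → Fin N) : ℕ :=
  sInf {n | ∏ i ∈ Finset.range n, F.ratio (ω i) ≤ r}

theorem prod_ratio_scaleTime_le {r : ℝ} (hr : 0 < r) (ω : ℕ → Fin N) :
    ∏ i ∈ Finset.range (F.scaleTime r ω), F.ratio (ω i) ≤ r := by
  have : {n | ∏ i ∈ Finset.range n, F.ratio (ω i) ≤ r}.Nonempty :=
    ((F.tendsto_prod_ratio ω).eventually (ge_mem_nhds hr)).exists
  exact Nat.sInf_mem this

theorem lt_prod_ratio_of_lt_scaleTime {r : ℝ} {ω : ℕ → Fin N} {n : ℕ} (h : n < F.scaleTime r ω) :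
    r < ∏ i ∈ Finset.range n, F.ratio (ω i) :=
  not_le.1 (Nat.notMem_of_lt_sInf h)

theorem le_prod_ratio_scaleTime {a r : ℝ} (ha : 0 < a) (ha1 : a ≤ 1) (har : ∀ i, a ≤ F.ratio i)
    (hr : 0 < r) (hr1 : r ≤ 1) (ω : ℕ → Fin N) :
    a * r ≤ ∏ i ∈ Finset.range (F.scaleTime r ω), F.ratio (ω i) := by
  rcases h : F.scaleTime r ω with _ | n
  · simpa using mul_le_one₀ ha1 hr.le hr1
  · have := F.lt_prod_ratio_of_lt_scaleTime (h ▸ Nat.lt_succ_self n : n < F.scaleTime r ω)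
    rw [Finset.prod_range_succ, mul_comm]
    exact mul_le_mul this.le (har _) ha.le (F.prod_ratio_pos ω n).le

theorem exists_prod_ratio_ge (n : ℕ) :
    ∃ r : ℝ, 0 < r ∧ r ≤ 1 ∧ ∀ ω, n ≤ F.scaleTime r ω := by
  obtain ⟨a, b, ha, ha1, -, -, hab⟩ := F.exists_ratio_bounds
  refine ⟨a ^ n / 2, by positivity, by linarith [pow_le_one₀ (n := n) ha.le ha1], fun ω => ?_⟩
  by_contra! h
  have h1 := F.prod_ratio_anti ω h.le
  have h2 := F.prod_ratio_scaleTime_le (by positivity : 0 < a ^ n / 2) ω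
  have h3 : a ^ n ≤ ∏ i ∈ Finset.range n, F.ratio (ω i) := by
    calc a ^ n = ∏ i ∈ Finset.range n, a := by simp
      _ ≤ _ := Finset.prod_le_prod (fun _ _ => ha.le) fun _ _ => (hab _).1
  have h4 : 0 < a ^ n := by positivity
  linarith

/-- Under the open set condition every point has finitely many codings. -/
theorem OpenSetCondition.finite_setOf_coding_eq {F : SimilarityIFS d N} (hF : F.OpenSetCondition)
    (x : EuclideanSpace ℝ (Fin d)) : {ω | F.coding ω = x}.Finite := by
  obtain ⟨a, b, ha, ha1, -, -, hab⟩ := F.exists_ratio_bounds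
  obtain ⟨M, hM⟩ := hF.exists_card_le ha
  by_contra hinf
  obtain ⟨I, hI, hcard⟩ := Set.Infinite.exists_subset_card_eq hinf (M + 1)
  -- a length at which the finitely many sequences of `I` have been separated
  obtain ⟨n, hn⟩ : ∃ n, ∀ ω ∈ I, ∀ ω' ∈ I, PiNat.firstDiff ω' ω < n := by
    refine ⟨(I ×ˢ I).sup (fun q => PiNat.firstDiff q.2 q.1) + 1, fun ω hω ω' hω' =>
      Nat.lt_succ_of_le ?_⟩
    exact Finset.le_sup (f := fun q : (ℕ → Fin N) × (ℕ → Fin N) => PiNat.firstDiff q.2 q.1)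
      (Finset.mk_mem_product hω hω')
  obtain ⟨r, hr, hr1, hrn⟩ := F.exists_prod_ratio_ge n
  have := hM r hr (F.scaleTime r) I (fun ω _ => F.prod_ratio_scaleTime_le hr ω)
    (fun ω _ => F.le_prod_ratio_scaleTime ha ha1 (fun i => (hab i).1) hr hr1 ω)
    (fun ω hω ω' hω' => by
      have h1 : F.coding ω = x := hI hω
      have h2 : F.coding ω' = x := hI hω'
      rw [h1, h2, dist_self]; exact hr.le)
    (fun ω hω ω' hω' hne hmem => by
      rw [PiNat.mem_cylinder_iff_le_firstDiff hne.symm] at hmem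
      have := hn ω hω ω' hω'
      have := hrn ω
      omega)
  omega

/-- Prefixing the letter `i` maps the finite set of codings of the fixed point of `f_i`
injectively into itself, hence onto itself, so that every coding of it begins with `i`. -/
theorem OpenSetCondition.eq_const_of_coding_eq {F : SimilarityIFS d N} (hF : F.OpenSetCondition)
    {i : Fin N} {ω : ℕ → Fin N} (h : F.coding ω = F.coding fun _ => i) : ω = fun _ => i := by
  let S := {ω | F.coding ω = F.coding fun _ => i}
  let pre : (ℕ → Fin N) → ℕ → Fin N := fun ω n => Nat.casesOn n i ω
  have hpre : MapsTo pre S S := by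
    intro ω (hω : F.coding ω = _)
    change F.coding (pre ω) = _
    have h1 := F.coding_eq_wordMap (pre ω) 1
    have h2 := F.coding_eq_wordMap (fun _ => i) 1
    have h3 : (fun k => pre ω (1 + k)) = ω := by
      funext k; rw [add_comm]
    rw [h3, hω] at h1
    rw [h1]; exact h2.symm
  have hinj : InjOn pre S := fun ω _ ω' _ hh => by
    funext k; exact congrFun hh (k + 1)
  have hsurj : SurjOn pre S S :=
    (((hF.finite_setOf_coding_eq _).injOn_iff_bijOn_of_mapsTo hpre).1 hinj).surjOn
  have hall : ∀ n, ∀ ω ∈ S, ω n = i := by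
    intro n
    induction n with
    | zero => intro ω hω; obtain ⟨ω', -, rfl⟩ := hsurj hω; rfl
    | succ n ih => intro ω hω; obtain ⟨ω', hω', rfl⟩ := hsurj hω; exact ih ω' hω'
  exact funext fun n => hall n ω h

/-- A set of small diameter `r` is coded by boundedly many cylinders of size comparable to `r`. -/
theorem OpenSetCondition.exists_cover {F : SimilarityIFS d N} (hF : F.OpenSetCondition) :
    ∃ M : ℕ, ∀ (r : ℝ), 0 < r → r ≤ 1 → ∀ A : Set (EuclideanSpace ℝ (Fin d)),
      (∀ x ∈ A, ∀ y ∈ A, dist x y ≤ r) →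
      ∃ I : Finset (ℕ → Fin N), I.card ≤ M ∧
        F.coding ⁻¹' A ⊆ ⋃ ω ∈ I, PiNat.cylinder ω (F.scaleTime r ω) := by
  classical
  obtain ⟨a, b, ha, ha1, -, -, hab⟩ := F.exists_ratio_bounds
  obtain ⟨M, hM⟩ := hF.exists_card_le ha
  refine ⟨M, fun r hr hr1 A hA => ?_⟩
  let Q : Finset (ℕ → Fin N) → Prop := fun I => (∀ ω ∈ I, F.coding ω ∈ A) ∧
    ∀ ω ∈ I, ∀ ω' ∈ I, ω ≠ ω' → ω' ∉ PiNat.cylinder ω (F.scaleTime r ω)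
  have hQM : ∀ I, Q I → I.card ≤ M := fun I hI => hM r hr (F.scaleTime r) I
    (fun ω _ => F.prod_ratio_scaleTime_le hr ω)
    (fun ω _ => F.le_prod_ratio_scaleTime ha ha1 (fun i => (hab i).1) hr hr1 ω)
    (fun ω hω ω' hω' => hA _ (hI.1 ω hω) _ (hI.1 ω' hω')) hI.2
  -- a family of incomparable prefixes of maximal cardinality covers
  let P : ℕ → Prop := fun n => ∃ I, Q I ∧ I.card = n
  have hP0 : P 0 := ⟨∅, ⟨by simp, by simp⟩, rfl⟩
  have hspec := Nat.findGreatest_spec (P := P) (Nat.zero_le M) hP0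
  obtain ⟨I, hQI, hI⟩ := hspec
  refine ⟨I, hQM I hQI, fun ω hω => ?_⟩
  by_contra hcon
  simp only [mem_iUnion, not_exists] at hcon
  have hωI : ω ∉ I := fun h => hcon ω h (PiNat.self_mem_cylinder _ _)
  have hback : ∀ ω' ∈ I, ω' ∉ PiNat.cylinder ω (F.scaleTime r ω) := by
    intro ω' hω' hmem
    refine hcon ω' hω' ?_
    have hle : F.scaleTime r ω' ≤ F.scaleTime r ω := by
      refine Nat.sInf_le ?_
      change _ ≤ r
      rw [F.prod_ratio_congr hmem]
      exact F.prod_ratio_scaleTime_le hr ω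
    exact fun i hi => (hmem i (hi.trans_le hle)).symm
  have hQ' : Q (insert ω I) := by
    constructor
    · intro ω' hω'
      rcases Finset.mem_insert.1 hω' with rfl | h
      · exact hω
      · exact hQI.1 ω' h
    · intro ω₁ h₁ ω₂ h₂ hne
      rcases Finset.mem_insert.1 h₁ with e₁ | e₁ <;> rcases Finset.mem_insert.1 h₂ with e₂ | e₂
      · exact absurd (e₁.trans e₂.symm) hne
      · exact e₁ ▸ hback ω₂ e₂
      · exact e₂ ▸ hcon ω₁ e₁
      · exact hQI.2 ω₁ e₁ ω₂ e₂ hne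
  have hcard : (insert ω I).card = I.card + 1 := Finset.card_insert_of_notMem hωI
  have hP' : P (I.card + 1) := ⟨_, hQ', hcard⟩
  have := Nat.le_findGreatest (hcard ▸ hQM _ hQ') hP'
  omega

/-! ### Bounds for Hausdorff measures of coded sets -/

/-- The mass distribution principle, on the symbolic side. -/
theorem OpenSetCondition.le_dimH_coding_image {F : SimilarityIFS d N} (hF : F.OpenSetCondition)
    (μ : Measure (ℕ → Fin N)) {t C : ℝ} (ht : 0 < t)
    (h : ∀ ω n, μ (PiNat.cylinder ω n) ≤
      ENNReal.ofReal (C * (∏ i ∈ Finset.range n, F.ratio (ω i)) ^ t))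
    {A : Set (ℕ → Fin N)} (hA : μ A ≠ 0) :
    ENNReal.ofReal t ≤ dimH (F.coding '' A) := by
  wlog hC : 0 ≤ C generalizing C
  · refine this (C := 0) (fun ω n => (h ω n).trans (ENNReal.ofReal_le_ofReal ?_)) le_rfl
    have : 0 ≤ (∏ i ∈ Finset.range n, F.ratio (ω i)) ^ t :=
      Real.rpow_nonneg (F.prod_ratio_pos ω n).le t
    nlinarith
  obtain ⟨M, hM⟩ := hF.exists_cover
  let ν : Measure (EuclideanSpace ℝ (Fin d)) := μ.map F.coding
  have hball : ∀ (r : ℝ), 0 < r → r ≤ 1 → ∀ B : Set (EuclideanSpace ℝ (Fin d)),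
      MeasurableSet B → (∀ x ∈ B, ∀ y ∈ B, dist x y ≤ r) → ν B ≤ M * ENNReal.ofReal (C * r ^ t) := by
    intro r hr hr1 B hBm hB
    obtain ⟨I, hI, hcov⟩ := hM r hr hr1 B hB
    calc ν B = μ (F.coding ⁻¹' B) := Measure.map_apply F.measurable_coding hBm
      _ ≤ μ (⋃ ω ∈ I, PiNat.cylinder ω (F.scaleTime r ω)) := measure_mono hcov
      _ ≤ ∑ ω ∈ I, μ (PiNat.cylinder ω (F.scaleTime r ω)) := measure_biUnion_finset_le _ _
      _ ≤ ∑ ω ∈ I, ENNReal.ofReal (C * r ^ t) := Finset.sum_le_sum fun ω _ =>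
          (h _ _).trans (ENNReal.ofReal_le_ofReal (mul_le_mul_of_nonneg_left
            (Real.rpow_le_rpow (F.prod_ratio_pos _ _).le (F.prod_ratio_scaleTime_le hr ω) ht.le) hC))
      _ = I.card * ENNReal.ofReal (C * r ^ t) := by rw [Finset.sum_const, nsmul_eq_mul]
      _ ≤ M * ENNReal.ofReal (C * r ^ t) := by gcongr
  -- the constant `M * C` is made positive so that it can be divided out
  let K : NNReal := M * C.toNNReal + 1
  have hK0 : (K : ENNReal) ≠ 0 := by
    have : (0 : NNReal) < K := by positivity
    exact_mod_cast this.ne'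
  have hKb : ∀ (r : ℝ), 0 < r → r ≤ 1 → ∀ B : Set (EuclideanSpace ℝ (Fin d)),
      MeasurableSet B → (∀ x ∈ B, ∀ y ∈ B, dist x y ≤ r) → ν B ≤ K * ENNReal.ofReal (r ^ t) := by
    intro r hr hr1 B hBm hB
    refine (hball r hr hr1 B hBm hB).trans ?_
    rw [ENNReal.ofReal_mul hC, ← mul_assoc]
    gcongr
    have : ENNReal.ofReal C = (C.toNNReal : ENNReal) := rfl
    rw [this]
    exact_mod_cast (le_add_of_nonneg_right zero_le_one : M * C.toNNReal ≤ M * C.toNNReal + 1)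
  have hdiam : ∀ B : Set (EuclideanSpace ℝ (Fin d)), MeasurableSet B → Metric.ediam B ≤ 1 / 2 →
      ν B ≤ K * Metric.ediam B ^ t := by
    intro B hBm hB
    have hfin : Metric.ediam B ≠ ⊤ := ne_top_of_le_ne_top (by simp) hB
    have hdist : ∀ x ∈ B, ∀ y ∈ B, dist x y ≤ (Metric.ediam B).toReal := fun x hx y hy => by
      rw [dist_edist]; exact ENNReal.toReal_mono hfin (Metric.edist_le_ediam_of_mem hx hy)
    have hle : (Metric.ediam B).toReal ≤ 1 / 2 := by
      have := ENNReal.toReal_mono (by simp) hB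
      simpa using this
    -- radii slightly larger than the diameter, since the diameter may vanish
    have hlim : Tendsto (fun ε : ℝ => K * ENNReal.ofReal (((Metric.ediam B).toReal + ε) ^ t))
        (𝓝[>] 0) (𝓝 (K * ENNReal.ofReal (((Metric.ediam B).toReal + 0) ^ t))) := by
      refine tendsto_nhdsWithin_of_tendsto_nhds ?_
      refine ENNReal.Tendsto.const_mul (ENNReal.tendsto_ofReal ?_) (Or.inr ENNReal.coe_ne_top)
      exact (tendsto_const_nhds.add tendsto_id).rpow_const (Or.inr ht.le)
    have := ge_of_tendsto (b := ν B) hlim ?_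
    · rwa [add_zero, ← ENNReal.ofReal_rpow_of_nonneg ENNReal.toReal_nonneg ht.le,
        ENNReal.ofReal_toReal hfin] at this
    · filter_upwards [Ioo_mem_nhdsGT (by norm_num : (0 : ℝ) < 1 / 2)] with ε hε
      have hd := ENNReal.toReal_nonneg (a := Metric.ediam B)
      exact hKb _ (by linarith [hε.1]) (by linarith [hε.2]) B hBm fun x hx y hy =>
        (hdist x hx y hy).trans (by linarith [hε.1])
  have hν : ν ≤ (K : ENNReal) • μH[t] := by
    have h1 : (K : ENNReal)⁻¹ • ν ≤ μH[t] := by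
      refine Measure.le_hausdorffMeasure t _ (1 / 2) (by simp) fun B hB => ?_
      -- replace `B` by its closure, which is measurable and has the same diameter
      have h2 := hdiam (closure B) isClosed_closure.measurableSet (by rwa [Metric.ediam_closure])
      rw [Metric.ediam_closure] at h2
      rw [Measure.smul_apply, smul_eq_mul]
      calc (K : ENNReal)⁻¹ * ν B ≤ (K : ENNReal)⁻¹ * (K * Metric.ediam B ^ t) := by
            gcongr; exact (measure_mono subset_closure).trans h2
        _ = Metric.ediam B ^ t := by
            rw [← mul_assoc, ENNReal.inv_mul_cancel hK0 ENNReal.coe_ne_top, one_mul]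
    calc ν = (K : ENNReal) • ((K : ENNReal)⁻¹ • ν) := by
          rw [smul_smul, ENNReal.mul_inv_cancel hK0 ENNReal.coe_ne_top, one_smul]
      _ ≤ (K : ENNReal) • μH[t] := by gcongr
  have hpos : ν (F.coding '' A) ≠ 0 := by
    intro h0
    refine hA (le_antisymm ?_ bot_le)
    calc μ A ≤ μ (F.coding ⁻¹' (F.coding '' A)) := measure_mono (subset_preimage_image _ _)
      _ ≤ ν (F.coding '' A) := Measure.le_map_apply F.measurable_coding.aemeasurable _
      _ = 0 := h0
  have hH : μH[((t.toNNReal : NNReal) : ℝ)] (F.coding '' A) ≠ 0 := by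
    intro h0
    rw [Real.coe_toNNReal t ht.le] at h0
    apply hpos
    have := hν (F.coding '' A)
    rw [Measure.smul_apply, h0, smul_zero] at this
    exact le_antisymm this bot_le
  exact le_dimH_of_hausdorffMeasure_ne_zero hH

/-- The convergence part of the first Borel–Cantelli lemma, for Hausdorff measures: the points
coded by the cylinders of infinitely many of the families `V L` form a null set. -/
theorem hausdorffMeasure_coding_image_frequently (V : (L : ℕ) → Set (Fin L → Fin N))
    {s : ℝ} (hs : 0 ≤ s)
    (hV : ∑' L, ∑' w : V L, ENNReal.ofReal (∏ i, F.ratio (w.1 i) ^ s) ≠ ⊤) :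
    μH[s] (F.coding '' {ω | ∃ᶠ L in atTop, (fun i : Fin L => ω i) ∈ V L}) = 0 := by
  obtain ⟨D, hD, hcod⟩ := F.exists_dist_coding_le
  obtain ⟨a, b, -, -, hb0, hb1, hab⟩ := F.exists_ratio_bounds
  let B : (Σ L, V L) → Set (EuclideanSpace ℝ (Fin d)) := fun w =>
    F.coding '' {ω | (fun i : Fin w.1 => ω i) = w.2.1}
  have hdist : ∀ w : Σ L, V L, ∀ x ∈ B w, ∀ y ∈ B w,
      dist x y ≤ (∏ i, F.ratio (w.2.1 i)) * D := by
    rintro ⟨L, w⟩ _ ⟨ω, hω, rfl⟩ _ ⟨ω', hω', rfl⟩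
    have h1 : ω' ∈ PiNat.cylinder ω L := fun i hi =>
      (congrFun (hω' : (fun i : Fin L => ω' i) = w) ⟨i, hi⟩).trans
        (congrFun (hω : (fun i : Fin L => ω i) = w) ⟨i, hi⟩).symm
    have h2 := F.dist_coding_le_of_mem_cylinder hcod h1
    have h3 : ∏ i ∈ Finset.range L, F.ratio (ω i) = ∏ i, F.ratio (w.1 i) := by
      rw [← hω, Finset.prod_range]
    rwa [h3] at h2
  have hprodpos : ∀ w : Σ L, V L, 0 ≤ ∏ i, F.ratio (w.2.1 i) := fun w =>
    Finset.prod_nonneg fun i _ => (F.ratio_pos _).le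
  have hediam : ∀ w : Σ L, V L, Metric.ediam (B w) ≤
      ENNReal.ofReal ((∏ i, F.ratio (w.2.1 i)) * D) := fun w =>
    Metric.ediam_le fun x hx y hy => by
      rw [edist_dist]; exact ENNReal.ofReal_le_ofReal (hdist w x hx y hy)
  let T : ℕ → ENNReal := fun K =>
    ∑' L : {L // L ∉ Finset.range K}, ∑' w : V L, ENNReal.ofReal (∏ i, F.ratio (w.1 i) ^ s)
  have hT : Tendsto T atTop (𝓝 0) :=
    (ENNReal.tendsto_tsum_compl_atTop_zero hV).comp Filter.tendsto_finset_range
  have hbT : Tendsto (fun K => ENNReal.ofReal (b ^ K * D)) atTop (𝓝 0) := by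
    have := ((tendsto_pow_atTop_nhds_zero_of_lt_one hb0 hb1).mul_const D)
    simpa using ENNReal.tendsto_ofReal this
  have key := Measure.hausdorffMeasure_le_liminf_tsum (ι := fun K : ℕ =>
      Σ L : {L // L ∉ Finset.range K}, V L) s
    (F.coding '' {ω | ∃ᶠ L in atTop, (fun i : Fin L => ω i) ∈ V L})
    (l := atTop) (fun K => ENNReal.ofReal (b ^ K * D)) hbT
    (fun K w => B ⟨w.1, w.2⟩)
    (Eventually.of_forall fun K w => by
      refine (hediam _).trans (ENNReal.ofReal_le_ofReal (mul_le_mul_of_nonneg_right ?_ hD.le))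
      have hK : K ≤ w.1.1 := not_lt.1 fun h => w.1.2 (Finset.mem_range.2 h)
      calc ∏ i, F.ratio (w.2.1 i) ≤ ∏ i : Fin w.1.1, b :=
            Finset.prod_le_prod (fun _ _ => (F.ratio_pos _).le) fun _ _ => (hab _).2
        _ = b ^ w.1.1 := by simp
        _ ≤ b ^ K := pow_le_pow_of_le_one hb0 hb1.le hK)
    (Eventually.of_forall fun K => by
      rintro _ ⟨ω, hω, rfl⟩
      obtain ⟨L, hL, hLV⟩ := (frequently_atTop.1 hω) K
      exact mem_iUnion.2 ⟨⟨⟨L, by simpa using hL⟩, ⟨_, hLV⟩⟩, ω, rfl, rfl⟩)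
  refine le_antisymm (key.trans ?_) bot_le
  have hbound : ∀ K, ∑' w : Σ L : {L // L ∉ Finset.range K}, V L, Metric.ediam (B ⟨w.1, w.2⟩) ^ s ≤
      ENNReal.ofReal (D ^ s) * T K := by
    intro K
    rw [ENNReal.tsum_sigma', ← ENNReal.tsum_mul_left]
    refine ENNReal.tsum_le_tsum fun L => ?_
    rw [← ENNReal.tsum_mul_left]
    refine ENNReal.tsum_le_tsum fun w => ?_
    refine (ENNReal.rpow_le_rpow (hediam ⟨L, w⟩) hs).trans ?_
    rw [ENNReal.ofReal_rpow_of_nonneg (mul_nonneg (hprodpos _) hD.le) hs,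
      Real.mul_rpow (hprodpos _) hD.le, mul_comm, ENNReal.ofReal_mul (by positivity),
      Real.finsetProd_rpow _ _ fun i _ => (F.ratio_pos _).le]
  have hlim : Tendsto (fun K => ENNReal.ofReal (D ^ s) * T K) atTop (𝓝 0) := by
    simpa using ENNReal.Tendsto.const_mul hT (Or.inr ENNReal.ofReal_ne_top)
  exact (liminf_le_liminf (Eventually.of_forall hbound)).trans hlim.liminf_eq.le

end SimilarityIFS

/-! ### Words under Bernoulli measures -/

section Words

variable {N : ℕ}

/-- The word of length `L` that the sequence `o` shows from position `m` on. -/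
def subword (m L : ℕ) (o : ℕ → Fin N) : Fin L → Fin N := fun i => o (m + i)

theorem measurable_subword (m L : ℕ) : Measurable (subword m L : (ℕ → Fin N) → Fin L → Fin N) :=
  measurable_pi_lambda _ fun i => measurable_pi_apply (m + i)

/-- The mass of a finite set of words of equal length: the sum of the products of the weights of
the letters. -/
noncomputable def wordMass (p : Fin N → ℝ) {L : ℕ} (S : Finset (Fin L → Fin N)) : ℝ :=
  ∑ w ∈ S, ∏ i, p (w i)

theorem sum_prod_word (g : Fin N → ℝ) (L : ℕ) :
    ∑ w : Fin L → Fin N, ∏ i, g (w i) = (∑ i, g i) ^ L := by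
  rw [Finset.sum_pow', Fintype.piFinset_univ]

theorem wordMass_nonneg {p : Fin N → ℝ} (hp : ∀ i, 0 < p i) {L : ℕ} (S : Finset (Fin L → Fin N)) :
    0 ≤ wordMass p S :=
  Finset.sum_nonneg fun _ _ => Finset.prod_nonneg fun _ _ => (hp _).le

theorem letterMeasure_singleton (p : Fin N → ℝ) (i : Fin N) :
    letterMeasure p {i} = ENNReal.ofReal (p i) := by
  classical
  simp [letterMeasure, Measure.finsetSum_apply, Set.indicator_apply]

theorem isProbabilityMeasure_bernoulliMeasure {p : Fin N → ℝ} (hp : ∀ i, 0 < p i)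
    (hsum : ∑ i, p i = 1) : IsProbabilityMeasure (bernoulliMeasure p) := by
  have := isProbabilityMeasure_letterMeasure p (fun i => (hp i).le) hsum
  unfold bernoulliMeasure
  infer_instance

theorem pi_letterMeasure_apply {p : Fin N → ℝ} (hp : ∀ i, 0 < p i)
    (hsum : ∑ i, p i = 1) {L : ℕ} (S : Finset (Fin L → Fin N)) :
    Measure.pi (fun _ : Fin L => letterMeasure p) (S : Set (Fin L → Fin N)) =
      ENNReal.ofReal (wordMass p S) := by
  have := isProbabilityMeasure_letterMeasure p (fun i => (hp i).le) hsum
  have h : ∀ w : Fin L → Fin N, Measure.pi (fun _ : Fin L => letterMeasure p) {w} =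
      ENNReal.ofReal (∏ i, p (w i)) := fun w => by
    rw [Measure.pi_singleton, ENNReal.ofReal_prod_of_nonneg fun _ _ => (hp _).le]
    simp only [letterMeasure_singleton]
  rw [← sum_measure_singleton, wordMass,
    ENNReal.ofReal_sum_of_nonneg fun _ _ => Finset.prod_nonneg fun _ _ => (hp _).le]
  exact Finset.sum_congr rfl fun w _ => h w

theorem bernoulliMeasure_subword_mem {p : Fin N → ℝ} (hp : ∀ i, 0 < p i)
    (hsum : ∑ i, p i = 1) (m : ℕ) {L : ℕ} (S : Finset (Fin L → Fin N)) :
    bernoulliMeasure p {o | subword m L o ∈ S} = ENNReal.ofReal (wordMass p S) := by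
  have := isProbabilityMeasure_letterMeasure p (fun i => (hp i).le) hsum
  have h : (bernoulliMeasure p).map (subword m L) =
      Measure.pi (fun _ : Fin L => letterMeasure p) := by
    rw [← Measure.infinitePi_eq_pi]
    exact Measure.map_infinitePi_infinitePi_of_inj (P := fun _ : ℕ => letterMeasure p)
      (f := fun i : Fin L => m + i) fun i j hij => Fin.ext (by simpa using hij)
  rw [← pi_letterMeasure_apply hp hsum, ← h, Measure.map_apply (measurable_subword m L)
    (Set.toFinite _).measurableSet]
  rfl

theorem wordMass_le_one {p : Fin N → ℝ} (hp : ∀ i, 0 < p i) (hsum : ∑ i, p i = 1) {L : ℕ}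
    (S : Finset (Fin L → Fin N)) : wordMass p S ≤ 1 := by
  have := isProbabilityMeasure_bernoulliMeasure hp hsum
  have h := prob_le_one (μ := bernoulliMeasure p) (s := {o | subword 0 L o ∈ S})
  rwa [bernoulliMeasure_subword_mem hp hsum, ENNReal.ofReal_le_one] at h

theorem wordMass_compl {p : Fin N → ℝ} (hsum : ∑ i, p i = 1) {L : ℕ}
    (S : Finset (Fin L → Fin N)) : wordMass p Sᶜ = 1 - wordMass p S := by
  have h : ∑ w : Fin L → Fin N, ∏ i, p (w i) = 1 := by
    rw [sum_prod_word, hsum, one_pow]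
  rw [wordMass, wordMass, eq_sub_iff_add_eq, add_comm, Finset.sum_add_sum_compl, h]

/-- Consecutive blocks of a Bernoulli sequence are independent. -/
theorem bernoulliMeasure_forall_block_notMem_le {p : Fin N → ℝ} (hp : ∀ i, 0 < p i)
    (hsum : ∑ i, p i = 1) (a J : ℕ) {L : ℕ} (S : Finset (Fin L → Fin N)) :
    bernoulliMeasure p {o | ∀ j < J, subword (a + j * L) L o ∉ S} ≤
      ENNReal.ofReal (Real.exp (-(J * wordMass p S))) := by
  have := isProbabilityMeasure_letterMeasure p (fun i => (hp i).le) hsum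
  let f : ℕ × Fin L → ℕ := fun q => a + q.1 * L + q.2
  have hf : Function.Injective f := by
    rintro ⟨j, i⟩ ⟨j', i'⟩ h
    have h' : j * L + i = j' * L + i' := by simp only [f] at h; omega
    have hL : 0 < L := i.pos
    have h1 : j = j' := by
      have := congrArg (· / L) h'
      simpa [mul_comm _ L, Nat.mul_add_div hL, Nat.div_eq_of_lt] using this
    subst h1
    have h2 : (i : ℕ) = i' := by omega
    rw [Fin.ext h2]
  have h1 := Measure.map_infinitePi_infinitePi_of_inj (P := fun _ : ℕ => letterMeasure p) hf
  have h2 := Measure.infinitePi_map_curry (fun (_ : ℕ) (_ : Fin L) => letterMeasure p)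
  have hmeas : Measurable fun (o : ℕ → Fin N) (q : ℕ × Fin L) => o (f q) :=
    measurable_pi_lambda _ fun q => measurable_pi_apply _
  have h3 : (bernoulliMeasure p).map (fun o j => subword (a + j * L) L o) =
      Measure.infinitePi fun _ : ℕ => Measure.pi fun _ : Fin L => letterMeasure p := by
    rw [← Measure.infinitePi_eq_pi, ← h2, ← h1, Measure.map_map (by fun_prop) hmeas]
    rfl
  have hset : {o : ℕ → Fin N | ∀ j < J, subword (a + j * L) L o ∉ S} =
      (fun o j => subword (a + j * L) L o) ⁻¹'
        (Set.pi (Finset.range J : Set ℕ) fun _ => ((Sᶜ : Finset (Fin L → Fin N)) : Set _)) := by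
    ext o; simp
  rw [hset, ← Measure.map_apply (measurable_pi_lambda _ fun j => measurable_subword _ _)
    (MeasurableSet.pi (Finset.countable_toSet _) fun _ _ => (Set.toFinite _).measurableSet),
    h3, Measure.infinitePi_pi _ (fun _ _ => (Set.toFinite _).measurableSet), Finset.prod_const,
    Finset.card_range,
    pi_letterMeasure_apply hp hsum, wordMass_compl hsum, ← ENNReal.ofReal_pow
    (sub_nonneg.2 (wordMass_le_one hp hsum S))]
  refine ENNReal.ofReal_le_ofReal ?_
  calc (1 - wordMass p S) ^ J ≤ Real.exp (-wordMass p S) ^ J :=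
        pow_le_pow_left₀ (sub_nonneg.2 (wordMass_le_one hp hsum S))
          (Real.one_sub_le_exp_neg _) J
    _ = Real.exp (-(J * wordMass p S)) := by rw [← Real.exp_nat_mul]; ring_nf

/-- The Chernoff bound: a sum of independent letters exceeds a multiple `c` of its length, with `c`
above the mean, with exponentially small probability. -/
theorem exists_wordMass_le_pow {p : Fin N → ℝ} (hp : ∀ i, 0 < p i) (hsum : ∑ i, p i = 1)
    (f : Fin N → ℝ) {c : ℝ} (hc : ∑ i, p i * f i < c) :
    ∃ η : ℝ, 0 < η ∧ η < 1 ∧ ∀ (L : ℕ) (S : Finset (Fin L → Fin N)),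
      (∀ w ∈ S, c * L ≤ ∑ i, f (w i)) → wordMass p S ≤ η ^ L := by
  let φ : ℝ → ℝ := fun θ => ∑ i, p i * Real.exp (θ * (f i - c))
  have hφ0 : φ 0 = 1 := by simp [φ, hsum]
  have hd : HasDerivAt φ (∑ i, p i * (f i - c)) 0 := by
    refine HasDerivAt.fun_sum fun i _ => ?_
    have := (((hasDerivAt_id (0 : ℝ)).mul_const (f i - c)).exp).const_mul (p i)
    simpa using this
  have hneg : ∑ i, p i * (f i - c) < 0 := by
    simp only [mul_sub, Finset.sum_sub_distrib, ← Finset.sum_mul, hsum]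
    linarith
  have hev : ∀ᶠ θ in 𝓝[>] (0 : ℝ), φ θ < φ 0 := by
    have h' : ∀ᶠ θ in 𝓝[>] (0 : ℝ), slope φ 0 θ < 0 :=
      ((hasDerivWithinAt_iff_tendsto_slope' (by simp)).1
        (hd.hasDerivWithinAt (s := Ioi 0))).eventually_lt_const hneg
    filter_upwards [h', self_mem_nhdsWithin] with θ h1 (h2 : 0 < θ)
    rw [slope_def_field, sub_zero] at h1
    have := (div_neg_iff.1 h1).resolve_left (fun h => by linarith [h.2])
    linarith [this.1]
  obtain ⟨θ, hθ, hθ0⟩ := (hev.and self_mem_nhdsWithin).exists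
  have hN : Nonempty (Fin N) := by
    by_contra h
    rw [not_nonempty_iff] at h
    simp at hsum
  have hpos : 0 < φ θ := Finset.sum_pos (fun i _ => mul_pos (hp i) (Real.exp_pos _))
    Finset.univ_nonempty
  refine ⟨φ θ, hpos, hφ0 ▸ hθ, fun L S hS => ?_⟩
  have hθ0 : 0 < θ := hθ0
  calc wordMass p S ≤ ∑ w ∈ S, ∏ i, (p (w i) * Real.exp (θ * (f (w i) - c))) := by
        refine Finset.sum_le_sum fun w hw => ?_
        rw [Finset.prod_mul_distrib, ← Real.exp_sum]
        refine le_mul_of_one_le_right (Finset.prod_nonneg fun _ _ => (hp _).le)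
          (Real.one_le_exp ?_)
        rw [← Finset.mul_sum, Finset.sum_sub_distrib]
        have := hS w hw
        simp only [Finset.sum_const, Finset.card_univ, Fintype.card_fin, nsmul_eq_mul]
        exact mul_nonneg hθ0.le (by linarith)
    _ ≤ ∑ w : Fin L → Fin N, ∏ i, (p (w i) * Real.exp (θ * (f (w i) - c))) :=
        Finset.sum_le_sum_of_subset_of_nonneg (Finset.subset_univ _) fun _ _ _ =>
          Finset.prod_nonneg fun _ _ => mul_nonneg (hp _).le (Real.exp_pos _).le
    _ = φ θ ^ L := sum_prod_word (fun i => p i * Real.exp (θ * (f i - c))) L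

theorem ae_eventually_sum_lt {p : Fin N → ℝ} (hp : ∀ i, 0 < p i) (hsum : ∑ i, p i = 1)
    (f : Fin N → ℝ) {c : ℝ} (hc : ∑ i, p i * f i < c) :
    ∀ᵐ x ∂bernoulliMeasure p, ∀ᶠ n : ℕ in atTop, ∑ i ∈ Finset.range n, f (x i) < c * n := by
  classical
  obtain ⟨η, hη0, hη1, h⟩ := exists_wordMass_le_pow hp hsum f hc
  let S : (L : ℕ) → Finset (Fin L → Fin N) := fun L => {w | c * L ≤ ∑ i, f (w i)}
  have hne : ∑' L, bernoulliMeasure p {x | subword 0 L x ∈ S L} ≠ ⊤ := by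
    refine ne_top_of_le_ne_top
      (summable_geometric_of_lt_one hη0.le hη1).tsum_ofReal_ne_top
      (ENNReal.tsum_le_tsum fun L => ?_)
    rw [bernoulliMeasure_subword_mem hp hsum]
    exact ENNReal.ofReal_le_ofReal (h L _ fun w hw => (Finset.mem_filter.1 hw).2)
  filter_upwards [ae_eventually_notMem hne] with x hx
  filter_upwards [hx] with n hn
  by_contra! hcon
  refine hn (Finset.mem_filter.2 ⟨Finset.mem_univ _, hcon.trans_eq ?_⟩)
  rw [Finset.sum_range]
  simp [subword]

end Words

/-! ### Lengths with a prescribed logarithmic growth -/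

section Growth

variable {α : ℝ} {ℓ : ℕ → ℕ}

theorem eventually_log_lt_of_liminf (hα : 0 < α)
    (hℓ : liminf (fun n : ℕ => (((ℓ n : ℝ) / Real.log (n : ℝ) : ℝ) : EReal)) atTop
      = ((1 / α : ℝ) : EReal)) {a : ℝ} (ha : α < a) :
    ∀ᶠ n : ℕ in atTop, Real.log n < a * ℓ n := by
  have h1 : ((1 / a : ℝ) : EReal) <
      liminf (fun n : ℕ => (((ℓ n : ℝ) / Real.log (n : ℝ) : ℝ) : EReal)) atTop := by
    rw [hℓ]; exact_mod_cast one_div_lt_one_div_of_lt hα ha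
  filter_upwards [eventually_lt_of_lt_liminf h1, eventually_gt_atTop 1] with n hn hn1
  have h2 : 1 / a < (ℓ n : ℝ) / Real.log n := by exact_mod_cast hn
  have h3 : 0 < Real.log n := Real.log_pos (by exact_mod_cast hn1)
  rw [div_lt_div_iff₀ (hα.trans ha) h3] at h2
  linarith

theorem frequently_lt_log_of_liminf {a : ℝ} (ha0 : 0 < a) (ha : a < α)
    (hℓ : liminf (fun n : ℕ => (((ℓ n : ℝ) / Real.log (n : ℝ) : ℝ) : EReal)) atTop
      = ((1 / α : ℝ) : EReal)) :
    ∃ᶠ n : ℕ in atTop, a * ℓ n < Real.log n := by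
  have h1 : liminf (fun n : ℕ => (((ℓ n : ℝ) / Real.log (n : ℝ) : ℝ) : EReal)) atTop <
      ((1 / a : ℝ) : EReal) := by
    rw [hℓ]; exact_mod_cast one_div_lt_one_div_of_lt ha0 ha
  refine ((frequently_lt_of_liminf_lt (by isBoundedDefault) h1).and_eventually
    (eventually_gt_atTop 1)).mono fun n ⟨hn, hn1⟩ => ?_
  have h2 : (ℓ n : ℝ) / Real.log n < 1 / a := by exact_mod_cast hn
  have h3 : 0 < Real.log n := Real.log_pos (by exact_mod_cast hn1)
  rw [div_lt_div_iff₀ h3 ha0] at h2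
  linarith

theorem tendsto_atTop_of_liminf (hα : 0 < α)
    (hℓ : liminf (fun n : ℕ => (((ℓ n : ℝ) / Real.log (n : ℝ) : ℝ) : EReal)) atTop
      = ((1 / α : ℝ) : EReal)) : Tendsto ℓ atTop atTop := by
  have h1 := eventually_log_lt_of_liminf hα hℓ (lt_add_one α)
  have h2 : Tendsto (fun n : ℕ => Real.log n / (α + 1)) atTop atTop :=
    (Real.tendsto_log_atTop.comp tendsto_natCast_atTop_atTop).atTop_div_const (by linarith)
  refine tendsto_natCast_atTop_iff (R := ℝ).1 (tendsto_atTop_mono' _ ?_ h2)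
  filter_upwards [h1] with n hn
  rw [div_le_iff₀ (by linarith)]
  linarith

end Growth

/-! ### Words that occur early in a typical sequence -/

/-- Polynomials are dominated by exponentials, in the form needed to sum the probabilities that
some word is missed. -/
theorem eventually_log_mul_le {a γ K : ℝ} (ha : 0 < a) (hγ0 : 0 ≤ γ) (hγ : γ < a) (hK : 0 ≤ K) :
    ∀ᶠ n : ℕ in atTop, ∀ L : ℕ, a * L < Real.log n →
      K * Real.log n ≤ ((n / 2 / (L + 1) : ℕ) : ℝ) * Real.exp (-(γ * L)) := by
  set c := 1 - γ / a with hc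
  have hc0 : 0 < c := by rw [hc, sub_pos, div_lt_one ha]; exact hγ
  let A := 2 * (1 / a + 1) * (K + 3)
  have hA : 0 < A := by positivity
  have hlog : Tendsto (fun n : ℕ => Real.log n) atTop atTop :=
    Real.tendsto_log_atTop.comp tendsto_natCast_atTop_atTop
  filter_upwards [hlog.eventually_ge_atTop 1, hlog.eventually_ge_atTop (6 * A / c ^ 3),
    eventually_gt_atTop 0] with n hx1 hxA hn L hL
  set x := Real.log n with hx
  have hn0 : (0 : ℝ) < n := by exact_mod_cast hn
  have hnx : (n : ℝ) = Real.exp x := (Real.exp_log hn0).symm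
  have hLx : (L : ℝ) ≤ x / a := by rw [le_div_iff₀ ha]; linarith
  -- lower bound for the number of blocks
  have hJ : (n : ℝ) / (2 * (L + 1)) - 2 ≤ ((n / 2 / (L + 1) : ℕ) : ℝ) := by
    rw [Nat.div_div_eq_div_mul]
    have h1 : n < 2 * (L + 1) * (n / (2 * (L + 1)) + 1) := Nat.lt_mul_div_succ n (by positivity)
    have h2 : (n : ℝ) ≤ 2 * (L + 1) * (((n / (2 * (L + 1)) : ℕ) : ℝ) + 1) := by exact_mod_cast h1.le
    have h3 : (n : ℝ) / (2 * (L + 1)) ≤ ((n / (2 * (L + 1)) : ℕ) : ℝ) + 1 := by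
      rw [div_le_iff₀ (by positivity)]; linarith
    linarith
  have hexp : A * x ^ 2 ≤ Real.exp (c * x) := by
    have h1 := Real.pow_div_factorial_le_exp (c * x) (by positivity) 3
    have h2 : (Nat.factorial 3 : ℝ) = 6 := by norm_num [Nat.factorial]
    rw [h2] at h1
    refine le_trans ?_ h1
    rw [div_le_iff₀ (by positivity)] at hxA
    rw [le_div_iff₀ (by norm_num)]
    nlinarith [mul_le_mul_of_nonneg_right hxA (sq_nonneg x)]
  have hγL : Real.exp (γ * L) ≤ Real.exp ((γ / a) * x) := by
    refine Real.exp_le_exp.2 ?_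
    calc γ * L ≤ γ * (x / a) := mul_le_mul_of_nonneg_left hLx hγ0
      _ = γ / a * x := by ring
  have hsplit : (n : ℝ) = Real.exp (γ / a * x) * Real.exp (c * x) := by
    rw [hnx, ← Real.exp_add]; congr 1; rw [hc]; ring
  have hE1 : 1 ≤ Real.exp (γ / a * x) := Real.one_le_exp (by positivity)
  have hmain : (K * x + 2) * Real.exp (γ / a * x) ≤ (n : ℝ) / (2 * (L + 1)) := by
    rw [le_div_iff₀ (by positivity), hsplit]
    have h1 : (K * x + 2) * (2 * (L + 1)) ≤ A * x ^ 2 := by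
      have h2 : (L : ℝ) + 1 ≤ (1 / a + 1) * x := by
        have : x / a = 1 / a * x := by ring
        nlinarith
      have h3 : K * x + 2 ≤ (K + 3) * x := by nlinarith
      calc (K * x + 2) * (2 * (L + 1)) ≤ ((K + 3) * x) * (2 * ((1 / a + 1) * x)) := by gcongr
        _ = A * x ^ 2 := by simp only [A]; ring
    calc (K * x + 2) * Real.exp (γ / a * x) * (2 * (L + 1))
        = Real.exp (γ / a * x) * ((K * x + 2) * (2 * (L + 1))) := by ring
      _ ≤ _ := mul_le_mul_of_nonneg_left (h1.trans hexp) (Real.exp_pos _).le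
  have h5 : K * x * Real.exp (γ / a * x) ≤ ((n / 2 / (L + 1) : ℕ) : ℝ) := by nlinarith
  rw [Real.exp_neg, ← div_eq_mul_inv, le_div_iff₀ (Real.exp_pos _)]
  exact (mul_le_mul_of_nonneg_left hγL (by positivity)).trans h5

/-- Let `𝒮 L` be at most exponentially many sets of words of length `L`, each of mass at least
`exp (-γ L)` with `γ < α`. Then, for infinitely many `n`, a typical sequence shows a word of each of
the sets in `𝒮 (ℓ n)` at a large time at which the length prescribed by `ℓ` is at most `ℓ n`.

The failure probability at `n` is superpolynomially small: about `n / ℓ n` independent blocks are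
available before time `n`, while the masses are at least `n ^ (-γ / α)`, up to small errors. -/
theorem ae_frequently_forall_exists_subword_mem {N : ℕ} {p : Fin N → ℝ} (hp : ∀ i, 0 < p i)
    (hsum : ∑ i, p i = 1) {α : ℝ} (hα : 0 < α) {ℓ : ℕ → ℕ} (hmono : Monotone ℓ)
    (hℓ : liminf (fun n : ℕ => (((ℓ n : ℝ) / Real.log (n : ℝ) : ℝ) : EReal)) atTop
      = ((1 / α : ℝ) : EReal))
    {γ : ℝ} (hγ : γ < α) {C : ℕ} (𝒮 : (L : ℕ) → Finset (Finset (Fin L → Fin N)))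
    (hcard : ∀ L, (𝒮 L).card ≤ C ^ L)
    (hmass : ∀ L, ∀ S ∈ 𝒮 L, Real.exp (-(γ * L)) ≤ wordMass p S) :
    ∀ᵐ o ∂bernoulliMeasure p, ∀ n₀, ∃ n ≥ n₀, ∀ S ∈ 𝒮 (ℓ n), ∃ m ≥ n₀,
      ℓ m ≤ ℓ n ∧ subword m (ℓ n) o ∈ S := by
  wlog hγ0 : 0 ≤ γ generalizing γ
  · refine this hα (fun L S hS => (Real.exp_le_exp.2 ?_).trans (hmass L S hS)) le_rfl
    have : γ * L ≤ 0 := mul_nonpos_of_nonpos_of_nonneg (not_le.1 hγ0).le (Nat.cast_nonneg L)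
    linarith
  obtain ⟨a, hγa, haα⟩ := exists_between hγ
  have ha : 0 < a := hγ0.trans_lt hγa
  let B := Real.log (C + 1) / a
  have hB : 0 ≤ B := div_nonneg (Real.log_nonneg (by simp)) ha.le
  obtain ⟨n₁, hn₁⟩ := eventually_atTop.1
    (eventually_log_mul_le ha hγ0 hγa (by positivity : 0 ≤ B + 2))
  -- the sequences that miss one of the sets in all blocks between `n / 2` and `n`
  let bad : ℕ → Set (ℕ → Fin N) := fun n =>
    {o | (n₁ ≤ n ∧ 1 ≤ n ∧ a * ℓ n < Real.log n) ∧ ∃ S ∈ 𝒮 (ℓ n), ∀ j < n / 2 / (ℓ n + 1),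
      subword (n / 2 + j * ℓ n) (ℓ n) o ∉ S}
  have hbad : ∀ n, bernoulliMeasure p (bad n) ≤ ENNReal.ofReal (1 / (n : ℝ) ^ 2) := by
    intro n
    by_cases hn : n₁ ≤ n ∧ 1 ≤ n ∧ a * ℓ n < Real.log n
    swap
    · have : bad n = ∅ := by ext o; simp [bad, hn]
      simp [this]
    have hn0 : (0 : ℝ) < n := by exact_mod_cast hn.2.1
    have hkey := hn₁ n hn.1 (ℓ n) hn.2.2
    set L := ℓ n
    set J := n / 2 / (L + 1)
    have hsub : bad n ⊆ ⋃ S ∈ 𝒮 L, {o | ∀ j < J, subword (n / 2 + j * L) L o ∉ S} := by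
      rintro o ⟨-, S, hS, h⟩
      exact mem_iUnion₂.2 ⟨S, hS, h⟩
    calc bernoulliMeasure p (bad n)
        ≤ ∑ S ∈ 𝒮 L, bernoulliMeasure p {o | ∀ j < J, subword (n / 2 + j * L) L o ∉ S} :=
          (measure_mono hsub).trans (measure_biUnion_finset_le _ _)
      _ ≤ ∑ S ∈ 𝒮 L, ENNReal.ofReal (Real.exp (-((B + 2) * Real.log n))) := by
          refine Finset.sum_le_sum fun S hS =>
            (bernoulliMeasure_forall_block_notMem_le hp hsum _ _ _).trans
              (ENNReal.ofReal_le_ofReal (Real.exp_le_exp.2 (neg_le_neg (hkey.trans ?_))))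
          exact mul_le_mul_of_nonneg_left (hmass L S hS) (Nat.cast_nonneg _)
      _ = ENNReal.ofReal ((𝒮 L).card * Real.exp (-((B + 2) * Real.log n))) := by
          rw [Finset.sum_const, nsmul_eq_mul, ENNReal.ofReal_mul (Nat.cast_nonneg _),
            ENNReal.ofReal_natCast]
      _ ≤ ENNReal.ofReal (1 / (n : ℝ) ^ 2) := by
          refine ENNReal.ofReal_le_ofReal ?_
          have h1 : ((𝒮 L).card : ℝ) ≤ Real.exp (B * Real.log n) := by
            calc ((𝒮 L).card : ℝ) ≤ (C : ℝ) ^ L := by exact_mod_cast hcard L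
              _ ≤ ((C : ℝ) + 1) ^ L := by gcongr; linarith
              _ = Real.exp (L * Real.log (C + 1)) := by
                  rw [Real.exp_nat_mul, Real.exp_log (by positivity)]
              _ ≤ Real.exp (B * Real.log n) := by
                  refine Real.exp_le_exp.2 ?_
                  have : (L : ℝ) * Real.log (C + 1) = B * (a * L) := by
                    simp only [B]; field_simp
                  rw [this]
                  exact mul_le_mul_of_nonneg_left hn.2.2.le hB
          calc ((𝒮 L).card : ℝ) * Real.exp (-((B + 2) * Real.log n))
              ≤ Real.exp (B * Real.log n) * Real.exp (-((B + 2) * Real.log n)) := by gcongr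
            _ = Real.exp (-(2 * Real.log n)) := by rw [← Real.exp_add]; ring_nf
            _ = 1 / (n : ℝ) ^ 2 := by
                rw [Real.exp_neg, ← Nat.cast_two, Real.exp_nat_mul, Real.exp_log hn0, one_div]
  have hne : ∑' n, bernoulliMeasure p (bad n) ≠ ⊤ :=
    ne_top_of_le_ne_top (Real.summable_one_div_nat_pow.2 one_lt_two).tsum_ofReal_ne_top
      (ENNReal.tsum_le_tsum hbad)
  filter_upwards [ae_eventually_notMem hne] with o ho n₀
  obtain ⟨n, hfreq, hgood, hn⟩ := ((frequently_lt_log_of_liminf ha haα hℓ).and_eventually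
    (ho.and (eventually_ge_atTop (max (max n₁ 1) (2 * n₀))))).exists
  have hn1 : n₁ ≤ n := (le_max_left _ _).trans ((le_max_left _ _).trans hn)
  have hn2 : 1 ≤ n := (le_max_right _ _).trans ((le_max_left _ _).trans hn)
  have hn3 : 2 * n₀ ≤ n := (le_max_right _ _).trans hn
  refine ⟨n, by omega, fun S hS => ?_⟩
  by_contra! hcon
  refine hgood ⟨⟨hn1, hn2, hfreq⟩, S, hS, fun j hj => ?_⟩
  refine hcon _ (by omega) (hmono ?_)
  have h1 : j * (ℓ n + 1) ≤ n / 2 :=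
    (Nat.mul_le_mul_right _ hj.le).trans (Nat.div_mul_le_self _ _)
  nlinarith [Nat.div_mul_le_self n 2, Nat.zero_le j]

/-! ### The pressure function -/

section Pressure

variable {N : ℕ}

/-- The sum `∑ λ_i ^ t u_i ^ q`, whose level set at `1` is the graph of the pressure function. -/
noncomputable def pressureSum (lam u : Fin N → ℝ) (t q : ℝ) : ℝ := ∑ i, lam i ^ t * u i ^ q

variable {lam u : Fin N → ℝ}

theorem pressureSum_strictAnti [Nonempty (Fin N)] (h0 : ∀ i, 0 < lam i) (h1 : ∀ i, lam i < 1)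
    (hu : ∀ i, 0 < u i) (q : ℝ) : StrictAnti fun t => pressureSum lam u t q := by
  intro t t' htt'
  exact Finset.sum_lt_sum_of_nonempty Finset.univ_nonempty fun i _ =>
    mul_lt_mul_of_pos_right (Real.rpow_lt_rpow_of_exponent_gt (h0 i) (h1 i) htt')
      (Real.rpow_pos_of_pos (hu i) q)

theorem continuous_pressureSum (h0 : ∀ i, 0 < lam i) (hu : ∀ i, 0 < u i) :
    Continuous fun x : ℝ × ℝ => pressureSum lam u x.1 x.2 :=
  continuous_finsetSum _ fun i _ =>
    (continuous_const.rpow continuous_fst fun _ => Or.inl (h0 i).ne').mul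
      (continuous_const.rpow continuous_snd fun _ => Or.inl (hu i).ne')

theorem tendsto_pressureSum_atTop (h0 : ∀ i, 0 < lam i) (h1 : ∀ i, lam i < 1) (q : ℝ) :
    Tendsto (fun t => pressureSum lam u t q) atTop (𝓝 0) := by
  have : Tendsto (fun t : ℝ => ∑ i, lam i ^ t * u i ^ q) atTop (𝓝 (∑ i : Fin N, 0 * u i ^ q)) :=
    tendsto_finsetSum _ fun i _ =>
      (tendsto_rpow_atTop_of_base_lt_one _ (by linarith [h0 i]) (h1 i)).mul_const _
  simpa [pressureSum] using this

theorem tendsto_pressureSum_atBot [Nonempty (Fin N)] (h0 : ∀ i, 0 < lam i) (h1 : ∀ i, lam i < 1)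
    (hu : ∀ i, 0 < u i) (q : ℝ) : Tendsto (fun t => pressureSum lam u t q) atBot atTop := by
  obtain ⟨i⟩ := ‹Nonempty (Fin N)›
  refine tendsto_atTop_mono (fun t => ?_) ((tendsto_rpow_atBot_of_base_lt_one (lam i) (h0 i)
    (h1 i)).atTop_mul_const (Real.rpow_pos_of_pos (hu i) q))
  exact Finset.single_le_sum (f := fun i => lam i ^ t * u i ^ q)
    (fun j _ => mul_nonneg (Real.rpow_nonneg (h0 j).le _) (Real.rpow_nonneg (hu j).le _))
    (Finset.mem_univ i)

theorem exists_pressure [Nonempty (Fin N)] (h0 : ∀ i, 0 < lam i) (h1 : ∀ i, lam i < 1)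
    (hu : ∀ i, 0 < u i) : ∃ P : ℝ → ℝ, ∀ q t, pressureSum lam u t q = 1 ↔ t = P q := by
  have hex : ∀ q, ∃ t, pressureSum lam u t q = 1 := by
    intro q
    have hc : Continuous fun t => pressureSum lam u t q :=
      (continuous_pressureSum h0 hu).comp (by fun_prop : Continuous fun t : ℝ => (t, q))
    obtain ⟨a, ha⟩ := ((tendsto_pressureSum_atTop (u := u) h0 h1 q).eventually
      (ge_mem_nhds (zero_lt_one' ℝ))).exists
    obtain ⟨b, hb⟩ := ((tendsto_pressureSum_atBot h0 h1 hu q).eventually_ge_atTop 1).exists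
    exact mem_range_of_exists_le_of_exists_ge hc ⟨a, ha⟩ ⟨b, hb⟩
  choose P hP using hex
  refine ⟨P, fun q t => ⟨fun h => ?_, fun h => h ▸ hP q⟩⟩
  exact (pressureSum_strictAnti h0 h1 hu q).injective (h.trans (hP q).symm)

variable {P : ℝ → ℝ}

theorem pressure_lt_iff [Nonempty (Fin N)] (h0 : ∀ i, 0 < lam i) (h1 : ∀ i, lam i < 1)
    (hu : ∀ i, 0 < u i) (hP : ∀ q t, pressureSum lam u t q = 1 ↔ t = P q) {q t : ℝ} :
    P q < t ↔ pressureSum lam u t q < 1 := by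
  rw [← (hP q (P q)).2 rfl]
  exact ((pressureSum_strictAnti h0 h1 hu q).lt_iff_gt).symm

theorem lt_pressure_iff [Nonempty (Fin N)] (h0 : ∀ i, 0 < lam i) (h1 : ∀ i, lam i < 1)
    (hu : ∀ i, 0 < u i) (hP : ∀ q t, pressureSum lam u t q = 1 ↔ t = P q) {q t : ℝ} :
    t < P q ↔ 1 < pressureSum lam u t q := by
  rw [← (hP q (P q)).2 rfl]
  exact ((pressureSum_strictAnti h0 h1 hu q).lt_iff_gt).symm

theorem continuous_pressure [Nonempty (Fin N)] (h0 : ∀ i, 0 < lam i) (h1 : ∀ i, lam i < 1)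
    (hu : ∀ i, 0 < u i) (hP : ∀ q t, pressureSum lam u t q = 1 ↔ t = P q) : Continuous P := by
  rw [OrderTopology.continuous_iff]
  have hc : ∀ t, Continuous fun q => pressureSum lam u t q := fun t =>
    (continuous_pressureSum h0 hu).comp (by fun_prop : Continuous fun q : ℝ => (t, q))
  intro a
  constructor
  · have : P ⁻¹' Ioi a = {q | 1 < pressureSum lam u a q} := by
      ext q; exact lt_pressure_iff h0 h1 hu hP
    rw [this]; exact isOpen_lt continuous_const (hc a)
  · have : P ⁻¹' Iio a = {q | pressureSum lam u a q < 1} := by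
      ext q; exact pressure_lt_iff h0 h1 hu hP
    rw [this]; exact isOpen_lt (hc a) continuous_const

/-- At a minimiser `q` of the pressure function on `[0, 1]` with value `s`, the vector
`λ_i ^ s u_i ^ q` is an equilibrium state: its entropy exceeds `s` times its Lyapunov exponent by
the positive part of `-∑ ρ_i log u_i`. This is the first order condition at `q`. -/
theorem entropy_eq_of_isMinOn_pressure [Nonempty (Fin N)] (h0 : ∀ i, 0 < lam i)
    (h1 : ∀ i, lam i < 1) (hu : ∀ i, 0 < u i)
    (hP : ∀ q t, pressureSum lam u t q = 1 ↔ t = P q) {q : ℝ} (hq : q ∈ Icc (0 : ℝ) 1)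
    (hmin : ∀ q' ∈ Icc (0 : ℝ) 1, P q ≤ P q') {ρ : Fin N → ℝ}
    (hρ : ρ = fun i => lam i ^ P q * u i ^ q) :
    ∑ i, ρ i * -Real.log (ρ i) =
      P q * ∑ i, ρ i * -Real.log (lam i) + max 0 (∑ i, ρ i * -Real.log (u i)) := by
  set s := P q
  have hlog : ∀ i, Real.log (ρ i) = s * Real.log (lam i) + q * Real.log (u i) := fun i => by
    rw [hρ]
    simp only
    rw [Real.log_mul (Real.rpow_pos_of_pos (h0 i) s).ne' (Real.rpow_pos_of_pos (hu i) q).ne',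
      Real.log_rpow (h0 i), Real.log_rpow (hu i)]
  have hd : HasDerivAt (fun q => pressureSum lam u s q) (∑ i, ρ i * Real.log (u i)) q := by
    refine HasDerivAt.fun_sum fun i _ => ?_
    have h := (((hasDerivAt_id q).const_rpow (hu i))).const_mul (lam i ^ s)
    simpa [hρ, mul_assoc, mul_comm, mul_left_comm] using h
  have hq1 : pressureSum lam u s q = 1 := (hP q s).2 rfl
  have hge : ∀ q' ∈ Icc (0 : ℝ) 1, pressureSum lam u s q ≤ pressureSum lam u s q' := by
    intro q' hq'
    rw [hq1]
    by_contra! h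
    exact absurd ((pressure_lt_iff h0 h1 hu hP).2 h) (not_lt.2 (hmin q' hq'))
  have hright : q < 1 → 0 ≤ ∑ i, ρ i * Real.log (u i) := by
    intro hlt
    have h := (hasDerivWithinAt_iff_tendsto_slope' (by simp)).1
      (hd.hasDerivWithinAt (s := Ioi q))
    refine ge_of_tendsto h ?_
    filter_upwards [Ioo_mem_nhdsGT hlt] with q' hq'
    rw [slope_def_field]
    exact div_nonneg (sub_nonneg.2 (hge q' ⟨hq.1.trans hq'.1.le, hq'.2.le⟩))
      (sub_nonneg.2 hq'.1.le)
  have hleft : 0 < q → ∑ i, ρ i * Real.log (u i) ≤ 0 := by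
    intro hlt
    have h := (hasDerivWithinAt_iff_tendsto_slope' (by simp)).1
      (hd.hasDerivWithinAt (s := Iio q))
    refine le_of_tendsto h ?_
    filter_upwards [Ioo_mem_nhdsLT hlt] with q' hq'
    rw [slope_def_field]
    exact div_nonpos_of_nonneg_of_nonpos (sub_nonneg.2 (hge q' ⟨hq'.1.le, hq'.2.le.trans hq.2⟩))
      (sub_nonpos.2 hq'.2.le)
  have hsumlog : ∑ i, ρ i * -Real.log (ρ i) =
      s * ∑ i, ρ i * -Real.log (lam i) + q * ∑ i, ρ i * -Real.log (u i) := by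
    rw [Finset.mul_sum, Finset.mul_sum, ← Finset.sum_add_distrib]
    refine Finset.sum_congr rfl fun i _ => ?_
    rw [hlog]; ring
  have hneg : ∑ i, ρ i * -Real.log (u i) = -∑ i, ρ i * Real.log (u i) := by
    simp
  rw [hsumlog, hneg]
  rcases hq.1.eq_or_lt with h | h
  · have h2 := hright (h ▸ one_pos)
    rw [← h, max_eq_left (by linarith)]; ring
  · rcases hq.2.eq_or_lt with h' | h'
    · rw [max_eq_right (by linarith [hleft h]), h']; ring
    · have h3 : ∑ i, ρ i * Real.log (u i) = 0 := le_antisymm (hleft h) (hright h')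
      simp [h3]

theorem pressure_nonneg [Nonempty (Fin N)] (h0 : ∀ i, 0 < lam i) (h1 : ∀ i, lam i < 1)
    {p : Fin N → ℝ} (hp : ∀ i, 0 < p i) (hsum : ∑ i, p i = 1) {α : ℝ} (hα : 0 < α)
    (hP : ∀ q t, pressureSum lam (fun i => p i * Real.exp α) t q = 1 ↔ t = P q)
    {q : ℝ} (hq : q ∈ Icc (0 : ℝ) 1) : 0 ≤ P q := by
  by_contra! h
  have h2 := (pressure_lt_iff h0 h1 (fun i => mul_pos (hp i) (Real.exp_pos α)) hP).1 h
  refine absurd h2 (not_lt.2 ?_)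
  rw [pressureSum, ← hsum]
  refine Finset.sum_le_sum fun i _ => ?_
  have hpi : p i ≤ 1 := hsum ▸ Finset.single_le_sum (fun j _ => (hp j).le) (Finset.mem_univ i)
  rw [Real.rpow_zero, one_mul, Real.mul_rpow (hp i).le (Real.exp_pos α).le]
  calc p i = p i ^ (1 : ℝ) := (Real.rpow_one _).symm
    _ ≤ p i ^ q := Real.rpow_le_rpow_of_exponent_ge (hp i) hpi hq.2
    _ ≤ p i ^ q * Real.exp α ^ q := le_mul_of_one_le_right (Real.rpow_nonneg (hp i).le _)
        (Real.one_le_rpow (Real.one_le_exp hα.le) hq.1)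

end Pressure

/-! ### The upper bound for the dimension -/

theorem leftShift_iterate {N : ℕ} (n : ℕ) (o : ℕ → Fin N) :
    leftShift^[n] o = fun k => o (n + k) := by
  induction n with
  | zero => simp
  | succ n ih =>
    rw [Function.iterate_succ_apply', ih]
    funext k
    simp only [leftShift]
    congr 1
    omega

theorem mem_cylinder_leftShift_iff {N : ℕ} {n L : ℕ} {o ω : ℕ → Fin N} :
    ω ∈ PiNat.cylinder (leftShift^[n] o) L ↔ subword n L o = fun i : Fin L => ω i := by
  rw [leftShift_iterate]
  refine ⟨fun h => funext fun i => (h i i.2).symm, fun h i hi => (congrFun h ⟨i, hi⟩).symm⟩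

/-- The words that occur in `o` up to time `exp (a L)`. -/
def earlyWords {N : ℕ} (a : ℝ) (o : ℕ → Fin N) (L : ℕ) : Set (Fin L → Fin N) :=
  {w | ∃ n : ℕ, (n : ℝ) ≤ Real.exp (a * L) ∧ subword n L o = w}

theorem bernoulliMeasure_mem_earlyWords_le {N : ℕ} {p : Fin N → ℝ} (hp : ∀ i, 0 < p i)
    (hsum : ∑ i, p i = 1) {a : ℝ} (ha : 0 < a) {q : ℝ} (hq : q ∈ Icc (0 : ℝ) 1) {L : ℕ}
    (w : Fin L → Fin N) :
    bernoulliMeasure p {o | w ∈ earlyWords a o L} ≤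
      ENNReal.ofReal (2 * ∏ i, (p (w i) * Real.exp a) ^ q) := by
  have := isProbabilityMeasure_bernoulliMeasure hp hsum
  set E := Real.exp (a * L) with hE
  have hE1 : 1 ≤ E := Real.one_le_exp (by positivity)
  have hpw : 0 < ∏ i, p (w i) := Finset.prod_pos fun _ _ => hp _
  set x := 2 * (E * ∏ i, p (w i)) with hx
  have hx0 : 0 < x := by positivity
  have h1 : bernoulliMeasure p {o | w ∈ earlyWords a o L} ≤ ENNReal.ofReal x := by
    have hsub : {o | w ∈ earlyWords a o L} ⊆
        ⋃ n ∈ Finset.range (⌊E⌋₊ + 1), {o | subword n L o ∈ ({w} : Finset (Fin L → Fin N))} := by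
      rintro o ⟨n, hn, hw⟩
      refine mem_iUnion₂.2 ⟨n, Finset.mem_range.2 (Nat.lt_succ_of_le (Nat.le_floor hn)), ?_⟩
      simpa using hw
    refine ((measure_mono hsub).trans (measure_biUnion_finset_le _ _)).trans ?_
    simp only [bernoulliMeasure_subword_mem hp hsum, Finset.sum_const, Finset.card_range,
      nsmul_eq_mul, wordMass, Finset.sum_singleton]
    rw [← ENNReal.ofReal_natCast, ← ENNReal.ofReal_mul (Nat.cast_nonneg _)]
    refine ENNReal.ofReal_le_ofReal ?_
    have : ((⌊E⌋₊ + 1 : ℕ) : ℝ) ≤ 2 * E := by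
      push_cast
      linarith [Nat.floor_le (zero_le_one.trans hE1)]
    calc ((⌊E⌋₊ + 1 : ℕ) : ℝ) * ∏ i, p (w i) ≤ 2 * E * ∏ i, p (w i) := by gcongr
      _ = x := by rw [hx]; ring
  have h2 : bernoulliMeasure p {o | w ∈ earlyWords a o L} ≤ ENNReal.ofReal (x ^ q) := by
    rcases le_total x 1 with hx1 | hx1
    · refine h1.trans (ENNReal.ofReal_le_ofReal ?_)
      simpa using Real.rpow_le_rpow_of_exponent_ge hx0 hx1 hq.2
    · refine prob_le_one.trans ?_
      rw [← ENNReal.ofReal_one]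
      exact ENNReal.ofReal_le_ofReal (Real.one_le_rpow hx1 hq.1)
  refine h2.trans (ENNReal.ofReal_le_ofReal ?_)
  have h3 : E * ∏ i, p (w i) = ∏ i, (p (w i) * Real.exp a) := by
    rw [Finset.prod_mul_distrib, mul_comm, hE, mul_comm a, Real.exp_nat_mul]
    simp
  rw [hx, h3, Real.mul_rpow zero_le_two
    (Finset.prod_nonneg fun i _ => (mul_pos (hp _) (Real.exp_pos a)).le),
    Real.finsetProd_rpow _ _ fun i _ => (mul_pos (hp _) (Real.exp_pos a)).le]
  refine mul_le_mul_of_nonneg_right ?_ (Real.rpow_nonneg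
    (Finset.prod_nonneg fun i _ => (mul_pos (hp _) (Real.exp_pos a)).le) _)
  calc (2 : ℝ) ^ q ≤ 2 ^ (1 : ℝ) := Real.rpow_le_rpow_of_exponent_le one_le_two hq.2
    _ = 2 := Real.rpow_one 2

/-- A word `w` of length `L` matters only if it occurs before time about `exp (α L)`, which has
probability at most `min 1 (exp (α L) p_w) ≤ (exp (α L) p_w) ^ q`. The expected `t`-dimensional size
of the cover at length `L` is thus a geometric sequence with ratio the pressure sum at `(t, q)`. -/
theorem SimilarityIFS.ae_hausdorffMeasure_coveringSet_eq_zero {d N : ℕ} (F : SimilarityIFS d N)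
    {p : Fin N → ℝ} (hp : ∀ i, 0 < p i) (hsum : ∑ i, p i = 1) {α : ℝ} (hα : 0 < α) {ℓ : ℕ → ℕ}
    (hℓ : liminf (fun n : ℕ => (((ℓ n : ℝ) / Real.log (n : ℝ) : ℝ) : EReal)) atTop
      = ((1 / α : ℝ) : EReal))
    {q : ℝ} (hq : q ∈ Icc (0 : ℝ) 1) {t : ℝ} (ht : 0 ≤ t)
    (hlt : pressureSum F.ratio (fun i => p i * Real.exp α) t q < 1) :
    ∀ᵐ o ∂bernoulliMeasure p, μH[t] (F.coveringSet o ℓ) = 0 := by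
  classical
  -- slightly more time than `exp (α L)`
  obtain ⟨a, hαa, hlt'⟩ : ∃ a, α < a ∧
      pressureSum F.ratio (fun i => p i * Real.exp a) t q < 1 := by
    have hc : Continuous fun a => pressureSum F.ratio (fun i => p i * Real.exp a) t q := by
      refine continuous_finsetSum _ fun i _ => continuous_const.mul ?_
      exact (continuous_const.mul Real.continuous_exp).rpow_const fun a =>
        Or.inl (mul_pos (hp i) (Real.exp_pos a)).ne'
    have h1 : ∀ᶠ a in 𝓝[>] α, pressureSum F.ratio (fun i => p i * Real.exp a) t q < 1 :=
      (hc.continuousWithinAt.tendsto).eventually_lt_const hlt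
    obtain ⟨a, h2, h3⟩ := (h1.and self_mem_nhdsWithin).exists
    exact ⟨a, h3, h2⟩
  have ha : 0 < a := hα.trans hαa
  set θ := pressureSum F.ratio (fun i => p i * Real.exp a) t q with hθ
  have hθ0 : 0 ≤ θ := Finset.sum_nonneg fun i _ => mul_nonneg (Real.rpow_nonneg (F.ratio_pos i).le _)
    (Real.rpow_nonneg (mul_pos (hp i) (Real.exp_pos a)).le _)
  have hmeas : ∀ (L : ℕ) (w : Fin L → Fin N), MeasurableSet {o | w ∈ earlyWords a o L} := by
    intro L w
    have : {o | w ∈ earlyWords a o L} =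
        ⋃ n : ℕ, {o | (n : ℝ) ≤ Real.exp (a * L) ∧ subword n L o = w} := by
      ext o; simp [earlyWords]
    rw [this]
    refine MeasurableSet.iUnion fun n => (MeasurableSet.const _).inter ?_
    exact measurable_subword n L (measurableSet_singleton w)
  let g : (L : ℕ) → (Fin L → Fin N) → ENNReal := fun L w =>
    ENNReal.ofReal (∏ i, F.ratio (w i) ^ t)
  let Y : (ℕ → Fin N) → ENNReal := fun o =>
    ∑' L, ∑ w : Fin L → Fin N, {o | w ∈ earlyWords a o L}.indicator (fun _ => g L w) o
  have hYm : ∀ (L : ℕ) (w : Fin L → Fin N),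
      Measurable ({o | w ∈ earlyWords a o L}.indicator fun _ => g L w) := fun L w =>
    measurable_const.indicator (hmeas L w)
  have hYint : ∫⁻ o, Y o ∂bernoulliMeasure p ≠ ⊤ := by
    have hsm : Summable fun L : ℕ => 2 * θ ^ L := (summable_geometric_of_lt_one hθ0 hlt').mul_left 2
    refine ne_top_of_le_ne_top hsm.tsum_ofReal_ne_top ?_
    rw [lintegral_tsum fun L => (Finset.measurable_fun_sum _ fun w _ => hYm L w).aemeasurable]
    refine ENNReal.tsum_le_tsum fun L => ?_
    rw [lintegral_finsetSum _ fun w _ => hYm L w]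
    calc ∑ w : Fin L → Fin N, ∫⁻ o, {o | w ∈ earlyWords a o L}.indicator (fun _ => g L w) o
          ∂bernoulliMeasure p
        ≤ ∑ w : Fin L → Fin N, ENNReal.ofReal (2 *
            ∏ i, (F.ratio (w i) ^ t * (p (w i) * Real.exp a) ^ q)) := by
          refine Finset.sum_le_sum fun w _ => ?_
          rw [lintegral_indicator_const (hmeas L w), Finset.prod_mul_distrib, mul_left_comm,
            ENNReal.ofReal_mul (Finset.prod_nonneg fun i _ =>
              Real.rpow_nonneg (F.ratio_pos _).le _)]
          exact mul_le_mul_right (bernoulliMeasure_mem_earlyWords_le hp hsum ha hq w) _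
      _ = ENNReal.ofReal (2 * θ ^ L) := by
          rw [← ENNReal.ofReal_sum_of_nonneg, ← Finset.mul_sum,
            sum_prod_word (fun i => F.ratio i ^ t * (p i * Real.exp a) ^ q)]
          · rfl
          · intro w _
            exact mul_nonneg zero_le_two (Finset.prod_nonneg fun i _ =>
              mul_nonneg (Real.rpow_nonneg (F.ratio_pos _).le _)
                (Real.rpow_nonneg (mul_pos (hp _) (Real.exp_pos a)).le _))
  have hYmeas : Measurable Y :=
    Measurable.tsum fun L => Finset.measurable_fun_sum _ fun w _ => hYm L w
  filter_upwards [ae_lt_top hYmeas hYint] with o ho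
  have hnull := F.hausdorffMeasure_coding_image_frequently (earlyWords a o) ht (by
    refine ne_top_of_le_ne_top ho.ne (ENNReal.tsum_le_tsum fun L => ?_)
    rw [tsum_subtype (earlyWords a o L) (g L), tsum_fintype]
    exact le_of_eq (Finset.sum_congr rfl fun w _ => by simp [Set.indicator_apply]))
  refine measure_mono_null (image_mono fun ω hω => ?_) hnull
  have h1 := hω.and_eventually ((eventually_log_lt_of_liminf hα hℓ hαa).and (eventually_ge_atTop 1))
  refine (tendsto_atTop_of_liminf hα hℓ).frequently (h1.mono fun n hn => ?_)
  obtain ⟨hn1, hn2, hn3⟩ := hn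
  refine ⟨n, ?_, mem_cylinder_leftShift_iff.1 hn1⟩
  rw [← Real.log_le_iff_le_exp (by exact_mod_cast hn3)]
  exact hn2.le

/-! ### Overwriting a sequence on sparse blocks -/

section Overwrite

variable {N : ℕ}

/-- The sequence `x`, overwritten successively on the blocks `[m j, B j)` with `j < k`: the new
letters on the block `j` are those of `e j` of the sequence obtained so far. -/
def overwriteStage (m B : ℕ → ℕ) (e : ℕ → (ℕ → Fin N) → ℕ → Fin N) :
    ℕ → (ℕ → Fin N) → ℕ → Fin N
  | 0, x, i => x i
  | k + 1, x, i =>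
      if m k ≤ i ∧ i < B k then e k (overwriteStage m B e k x) i else overwriteStage m B e k x i

/-- The sequence `x`, overwritten on all blocks `[m k, B k)`. Later blocks start beyond the index
`i` if `k ≤ m k` for all `k`, so that `i + 1` stages determine the letter at `i`. -/
def overwrite (m B : ℕ → ℕ) (e : ℕ → (ℕ → Fin N) → ℕ → Fin N) (x : ℕ → Fin N) : ℕ → Fin N :=
  fun i => overwriteStage m B e (i + 1) x i

variable {m B : ℕ → ℕ} {e : ℕ → (ℕ → Fin N) → ℕ → Fin N}

theorem overwriteStage_add (hm : Monotone m) {k i : ℕ} (hi : i < m k) (x : ℕ → Fin N) (j : ℕ) :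
    overwriteStage m B e (k + j) x i = overwriteStage m B e k x i := by
  induction j with
  | zero => rfl
  | succ j ih =>
    rw [← add_assoc, overwriteStage, if_neg, ih]
    rintro ⟨h, -⟩
    exact absurd (hi.trans_le (hm (Nat.le_add_right k j))) (not_lt.2 h)

theorem overwrite_eq_overwriteStage (hm : Monotone m) (hk : ∀ k, k ≤ m k) {k i : ℕ}
    (hi : i < m k) (x : ℕ → Fin N) : overwrite m B e x i = overwriteStage m B e k x i := by
  rcases le_total k (i + 1) with h | h
  · obtain ⟨j, hj⟩ := Nat.exists_eq_add_of_le h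
    rw [overwrite, hj, overwriteStage_add hm hi]
  · obtain ⟨j, rfl⟩ := Nat.exists_eq_add_of_le h
    rw [overwrite, overwriteStage_add hm (hk (i + 1))]

theorem overwrite_of_forall_not (x : ℕ → Fin N) {i : ℕ} (hi : ∀ k, ¬(m k ≤ i ∧ i < B k)) :
    overwrite m B e x i = x i := by
  have : ∀ k, overwriteStage m B e k x i = x i := by
    intro k
    induction k with
    | zero => rfl
    | succ k ih => rw [overwriteStage, if_neg (hi k), ih]
  exact this _

theorem overwrite_of_mem_block (hm : Monotone m) (hk : ∀ k, k ≤ m k) (hB : ∀ k, B k ≤ m (k + 1))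
    (he : ∀ k x y, y ∈ PiNat.cylinder x (m k) → e k y = e k x) (x : ℕ → Fin N) {k i : ℕ}
    (h1 : m k ≤ i) (h2 : i < B k) : overwrite m B e x i = e k (overwrite m B e x) i := by
  rw [overwrite_eq_overwriteStage hm hk (h2.trans_le (hB k)), overwriteStage, if_pos ⟨h1, h2⟩,
    he k (overwriteStage m B e k x) (overwrite m B e x)]
  exact fun j hj => overwrite_eq_overwriteStage hm hk hj x

theorem measurable_overwrite (he : ∀ k, Measurable (e k)) : Measurable (overwrite m B e) := by
  have : ∀ k, Measurable (overwriteStage m B e k) := by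
    intro k
    induction k with
    | zero => exact measurable_id
    | succ k ih =>
      refine measurable_pi_lambda _ fun i => ?_
      simp only [overwriteStage]
      split_ifs
      · exact (measurable_pi_apply i).comp ((he k).comp ih)
      · exact (measurable_pi_apply i).comp ih
  exact measurable_pi_lambda _ fun i => (measurable_pi_apply i).comp (this _)

theorem sum_range_le_add_sum_Ico {f : ℕ → ℝ} {M : ℝ} (hf : ∀ i, f i ≤ M) {k n : ℕ} (h : k ≤ n) :
    ∑ i ∈ Finset.range n, f i ≤ M * k + ∑ i ∈ Finset.Ico k n, f i := by
  rw [← Finset.sum_range_add_sum_Ico f h]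
  refine add_le_add_left ((Finset.sum_le_card_nsmul _ _ M fun i _ => hf i).trans_eq ?_) _
  simp [mul_comm]

/-- Comparison of the two exponents along an overwritten sequence `y`. Here `a` and `c` are the
logarithmic rates of contraction and of mass, with means `χ` and `h` along `x`; on the block
`[m, L)` the letters of `y` contribute to the first rate only, and `[0, l)` is negligible. -/
theorem mul_sum_sub_le_sum_of_block {a c : Fin N → ℝ} {M χ h ε κ t : ℝ} (hc0 : ∀ i, 0 ≤ c i)
    (haM : ∀ i, a i ≤ M) (hcM : ∀ i, c i ≤ M) (ha0 : ∀ i, 0 ≤ a i)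
    (ht : 0 ≤ t) (hh : 0 ≤ h) (hε : 0 ≤ ε) (hκ0 : 0 ≤ κ) (hcond : h * κ + 4 * ε + t * (χ + 4 * ε) ≤ h)
    {x y : ℕ → Fin N} {Z : Set ℕ} [DecidablePred (· ∈ Z)] {l m L n : ℕ}
    (hlm : l ≤ m) (hmL : m ≤ L) (hLn : L ≤ n)
    (hxy₁ : ∀ i, l ≤ i → i < m → i ∉ Z ∧ y i = x i) (hxy₂ : ∀ i, L ≤ i → i < n → i ∉ Z ∧ y i = x i)
    (hAm : ∑ i ∈ Finset.range m, a (x i) ≤ (χ + ε) * m)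
    (hAn : ∑ i ∈ Finset.range n, a (x i) ≤ (χ + ε) * n)
    (hAL : (χ - ε) * L ≤ ∑ i ∈ Finset.range L, a (x i))
    (hCm : (h - ε) * m ≤ ∑ i ∈ Finset.range m, c (x i))
    (hCn : (h - ε) * n ≤ ∑ i ∈ Finset.range n, c (x i))
    (hCL : ∑ i ∈ Finset.range L, c (x i) ≤ (h + ε) * L)
    (hl : M * l ≤ ε * m) (hblock : ∑ i ∈ Finset.Ico m L, a (y i) ≤ (χ + ε) * (L - m))
    (hκ : (L : ℝ) - m ≤ κ * L + 1) :
    t * ∑ i ∈ Finset.range n, a (y i) - h ≤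
      ∑ i ∈ (Finset.range n).filter (· ∉ Z), c (y i) := by
  have hmLr : (m : ℝ) ≤ L := by exact_mod_cast hmL
  have hLnr : (L : ℝ) ≤ n := by exact_mod_cast hLn
  have hA : ∑ i ∈ Finset.range n, a (y i) ≤ (χ + 4 * ε) * n := by
    have h1 : ∑ i ∈ Finset.range m, a (y i) ≤ M * l + ∑ i ∈ Finset.Ico l m, a (y i) :=
      sum_range_le_add_sum_Ico (fun i => haM (y i)) hlm
    have h2 : ∑ i ∈ Finset.Ico l m, a (y i) ≤ ∑ i ∈ Finset.range m, a (x i) := by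
      rw [Finset.sum_congr rfl fun i hi => by
        rw [(hxy₁ i (Finset.mem_Ico.1 hi).1 (Finset.mem_Ico.1 hi).2).2]]
      exact Finset.sum_le_sum_of_subset_of_nonneg
        (fun i hi => Finset.mem_range.2 (Finset.mem_Ico.1 hi).2) fun i _ _ => ha0 _
    have h3 : ∑ i ∈ Finset.Ico L n, a (y i) = ∑ i ∈ Finset.Ico L n, a (x i) :=
      Finset.sum_congr rfl fun i hi => by
        rw [(hxy₂ i (Finset.mem_Ico.1 hi).1 (Finset.mem_Ico.1 hi).2).2]
    have h4 := Finset.sum_range_add_sum_Ico (fun i => a (x i)) hLn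
    have h5 := Finset.sum_range_add_sum_Ico (fun i => a (y i)) hLn
    have h6 := Finset.sum_range_add_sum_Ico (fun i => a (y i)) hmL
    nlinarith
  have hC : h * n - h * (κ * L + 1) - 4 * ε * n ≤
      ∑ i ∈ (Finset.range n).filter (· ∉ Z), c (y i) := by
    have h1 : ∑ i ∈ Finset.Ico l m, c (x i) + ∑ i ∈ Finset.Ico L n, c (x i) ≤
        ∑ i ∈ (Finset.range n).filter (· ∉ Z), c (y i) := by
      rw [← Finset.sum_union]
      · have h2 : ∀ i ∈ Finset.Ico l m ∪ Finset.Ico L n, i < n ∧ i ∉ Z ∧ y i = x i := by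
          intro i hi
          rcases Finset.mem_union.1 hi with hi | hi
          · exact ⟨(Finset.mem_Ico.1 hi).2.trans_le (hmL.trans hLn),
              hxy₁ i (Finset.mem_Ico.1 hi).1 (Finset.mem_Ico.1 hi).2⟩
          · exact ⟨(Finset.mem_Ico.1 hi).2, hxy₂ i (Finset.mem_Ico.1 hi).1 (Finset.mem_Ico.1 hi).2⟩
        rw [← Finset.sum_congr rfl fun i hi => congrArg c (h2 i hi).2.2]
        refine Finset.sum_le_sum_of_subset_of_nonneg (fun i hi => ?_) fun i _ _ => hc0 _
        exact Finset.mem_filter.2 ⟨Finset.mem_range.2 (h2 i hi).1, (h2 i hi).2.1⟩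
      · refine Finset.disjoint_left.2 fun i hi hi' => ?_
        exact absurd ((Finset.mem_Ico.1 hi).2.trans_le hmL) (not_lt.2 (Finset.mem_Ico.1 hi').1)
    have h2 := sum_range_le_add_sum_Ico (fun i => hcM (x i)) hlm
    have h4 := Finset.sum_range_add_sum_Ico (fun i => c (x i)) hLn
    nlinarith [mul_le_mul_of_nonneg_left hκ hh]
  have h1 : h * (κ * L) ≤ h * κ * n := by
    rw [← mul_assoc]
    exact mul_le_mul_of_nonneg_left hLnr (mul_nonneg hh hκ0)
  have h2 := mul_le_mul_of_nonneg_left hA ht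
  have h3 := mul_le_mul_of_nonneg_right hcond (Nat.cast_nonneg (α := ℝ) n)
  linarith

end Overwrite

namespace SimilarityIFS

variable {d N : ℕ}

/-- The lower bound for the dimension of a limsup set, from the following extension property: for
arbitrarily large lengths `L`, every word of length `m L` along which `b` has at most about the
average `β` extends to a word of length `L` whose cylinder lies in a late `V n` and is not
contracted much more than is typical for `ρ`.

Overwriting a sequence on the blocks `[m L, L)`, for sparse `L`, by these extensions maps almost
every sequence into the limsup set. The image of the Bernoulli measure of `ρ` gives a cylinder at
most the `ρ`-mass of its letters outside of the blocks. -/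
theorem OpenSetCondition.le_dimH_coding_image_of_extension {F : SimilarityIFS d N}
    (hF : F.OpenSetCondition) {ρ : Fin N → ℝ} (hρ : ∀ i, 0 < ρ i) (hρsum : ∑ i, ρ i = 1)
    {b : Fin N → ℝ} (hb : ∀ i, 0 ≤ b i) {χ β h ε κ t : ℝ}
    (hχ : ∑ i, ρ i * -Real.log (F.ratio i) = χ) (hβ : ∑ i, ρ i * b i = β)
    (hh : ∑ i, ρ i * -Real.log (ρ i) = h) (ht : 0 < t) (hε : 0 < ε) (hκ0 : 0 ≤ κ)
    (hcond : h * κ + 4 * ε + t * (χ + 4 * ε) ≤ h)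
    {m : ℕ → ℕ} (hmL : ∀ L, m L ≤ L) (hm : Tendsto m atTop atTop)
    (hmκ : ∀ L : ℕ, (L : ℝ) - m L ≤ κ * L + 1) {V : ℕ → Set (ℕ → Fin N)}
    (hext : ∀ K, ∃ L ≥ K, ∀ x : ℕ → Fin N,
      ∑ i ∈ Finset.range (m L), b (x i) ≤ (β + 2 * ε) * m L →
      ∃ y ∈ PiNat.cylinder x (m L),
        ∑ i ∈ Finset.Ico (m L) L, -Real.log (F.ratio (y i)) ≤ (χ + ε) * (L - m L) ∧
        ∃ n ≥ K, PiNat.cylinder y L ⊆ V n) :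
    ENNReal.ofReal t ≤ dimH (F.coding '' {ω | ∃ᶠ n in atTop, ω ∈ V n}) := by
  classical
  have hprob := isProbabilityMeasure_bernoulliMeasure hρ hρsum
  have hρ1 : ∀ i, ρ i ≤ 1 := fun i =>
    hρsum ▸ Finset.single_le_sum (fun j _ => (hρ j).le) (Finset.mem_univ i)
  let a : Fin N → ℝ := fun i => -Real.log (F.ratio i)
  let c : Fin N → ℝ := fun i => -Real.log (ρ i)
  have ha0 : ∀ i, 0 ≤ a i := fun i =>
    neg_nonneg.2 (Real.log_nonpos (F.ratio_pos i).le (F.ratio_lt_one i).le)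
  have hc0 : ∀ i, 0 ≤ c i := fun i => neg_nonneg.2 (Real.log_nonpos (hρ i).le (hρ1 i))
  have hh0 : 0 ≤ h := hh ▸ Finset.sum_nonneg fun i _ => mul_nonneg (hρ i).le (hc0 i)
  obtain ⟨M, hM0, hM⟩ : ∃ M : ℝ, 0 ≤ M ∧ ∀ i, a i ≤ M ∧ b i ≤ M ∧ c i ≤ M := by
    have hle : ∀ f : Fin N → ℝ, (∀ i, 0 ≤ f i) → ∀ i, f i ≤ ∑ j, f j := fun f hf i =>
      Finset.single_le_sum (fun j _ => hf j) (Finset.mem_univ i)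
    have hsa := Finset.sum_nonneg fun i (_ : i ∈ Finset.univ) => ha0 i
    have hsb := Finset.sum_nonneg fun i (_ : i ∈ Finset.univ) => hb i
    have hsc := Finset.sum_nonneg fun i (_ : i ∈ Finset.univ) => hc0 i
    exact ⟨∑ i, a i + ∑ i, b i + ∑ i, c i, by positivity, fun i =>
      ⟨by linarith [hle a ha0 i], by linarith [hle b hb i], by linarith [hle c hc0 i]⟩⟩
  have hN : Nonempty (Fin N) := by
    by_contra hcon
    rw [not_nonempty_iff] at hcon
    simp at hρsum
  obtain ⟨i₀⟩ := hN
  -- the sparse sequence of lengths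
  have hnext : ∀ l k : ℕ, ∃ L, l ≤ m L ∧ k ≤ m L ∧ M * l ≤ ε * m L ∧ ∀ x : ℕ → Fin N,
      ∑ i ∈ Finset.range (m L), b (x i) ≤ (β + 2 * ε) * m L →
      ∃ y ∈ PiNat.cylinder x (m L),
        ∑ i ∈ Finset.Ico (m L) L, a (y i) ≤ (χ + ε) * (L - m L) ∧
        ∃ n ≥ k, PiNat.cylinder y L ⊆ V n := by
    intro l k
    obtain ⟨K, hK⟩ := eventually_atTop.1 ((hm.eventually_ge_atTop (max l k)).and
      ((tendsto_natCast_atTop_atTop (R := ℝ).comp hm).eventually_ge_atTop (M * l / ε)))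
    obtain ⟨L, hLK, hL⟩ := hext (max K k)
    obtain ⟨h1, h2⟩ := hK L ((le_max_left _ _).trans hLK)
    refine ⟨L, (le_max_left _ _).trans h1, (le_max_right _ _).trans h1, ?_, fun x hx => ?_⟩
    · rw [div_le_iff₀ hε] at h2
      rw [mul_comm ε]; exact h2
    · obtain ⟨y, hy, hya, n, hn, hyn⟩ := hL x hx
      exact ⟨y, hy, hya, n, (le_max_right _ _).trans hn, hyn⟩
  choose nxt hnl hnk hnε hnext using hnext
  let E : ℕ → ℕ := fun k => Nat.rec 0 (fun k l => nxt l k) k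
  let m' : ℕ → ℕ := fun k => m (E (k + 1))
  let B : ℕ → ℕ := fun k => E (k + 1)
  have hEm : ∀ k, E k ≤ m' k := fun k => hnl (E k) k
  have hkm : ∀ k, k ≤ m' k := fun k => hnk (E k) k
  have hmB : ∀ k, m' k ≤ B k := fun k => hmL _
  have hBm : ∀ k, B k ≤ m' (k + 1) := fun k => hEm (k + 1)
  have hm'mono : Monotone m' := monotone_nat_of_le_succ fun k => (hmB k).trans (hBm k)
  have hEmono : Monotone E := monotone_nat_of_le_succ fun k => (hEm k).trans (hmB k)
  -- the extensions, as functions of the word to be extended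
  have hfun : ∀ (k : ℕ) (w : Fin (m' k) → Fin N), ∃ y : ℕ → Fin N,
      ∀ x : ℕ → Fin N, (∀ i : Fin (m' k), x i = w i) → y ∈ PiNat.cylinder x (m' k) ∧
        (∑ i ∈ Finset.range (m' k), b (x i) ≤ (β + 2 * ε) * m' k →
          ∑ i ∈ Finset.Ico (m' k) (B k), a (y i) ≤ (χ + ε) * (B k - m' k) ∧
          ∃ n ≥ k, PiNat.cylinder y (B k) ⊆ V n) := by
    intro k w
    let x₀ : ℕ → Fin N := fun i => if hi : i < m' k then w ⟨i, hi⟩ else i₀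
    have hx₀ : ∀ x : ℕ → Fin N, (∀ i : Fin (m' k), x i = w i) → ∀ i < m' k, x₀ i = x i := by
      intro x hx i hi
      simp only [x₀, hi, dif_pos]
      exact (hx ⟨i, hi⟩).symm
    by_cases hgood : ∑ i ∈ Finset.range (m' k), b (x₀ i) ≤ (β + 2 * ε) * m' k
    · obtain ⟨y, hy, hyV⟩ := hnext (E k) k x₀ hgood
      exact ⟨y, fun x hx => ⟨fun i hi => (hy i hi).trans (hx₀ x hx i hi), fun _ => hyV⟩⟩
    · refine ⟨x₀, fun x hx => ⟨hx₀ x hx, fun hcon => absurd ?_ hgood⟩⟩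
      rwa [Finset.sum_congr rfl fun i hi => by rw [hx₀ x hx i (Finset.mem_range.1 hi)]]
  choose e' he' using hfun
  let e : ℕ → (ℕ → Fin N) → ℕ → Fin N := fun k x => e' k fun i => x i
  have he : ∀ k x y, y ∈ PiNat.cylinder x (m' k) → e k y = e k x := fun k x y hy =>
    congrArg (e' k) (funext fun i => hy i i.2)
  have hem : ∀ k, Measurable (e k) := fun k =>
    (measurable_of_finite (e' k)).comp (measurable_pi_lambda _ fun i => measurable_pi_apply _)
  let g : (ℕ → Fin N) → ℕ → Fin N := overwrite m' B e
  have hg : Measurable g := measurable_overwrite hem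
  let Z : Set ℕ := {i | ∃ k, m' k ≤ i ∧ i < B k}
  have hgZ : ∀ x, ∀ i ∉ Z, g x i = x i := fun x i hi =>
    overwrite_of_forall_not x fun k hk => hi ⟨k, hk⟩
  have hgap : ∀ k i, E k ≤ i → i < m' k → i ∉ Z := by
    rintro k i h1 h2 ⟨j, h3, h4⟩
    rcases lt_or_ge j k with hj | hj
    · exact absurd (h4.trans_le ((hEmono (Nat.succ_le_of_lt hj)).trans h1)) (lt_irrefl _)
    · exact absurd (h2.trans_le ((hm'mono hj).trans h3)) (lt_irrefl _)
  have hgcyl : ∀ x k, g x ∈ PiNat.cylinder (e k (g x)) (B k) := by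
    intro x k i hi
    rcases lt_or_ge i (m' k) with h1 | h1
    · exact ((he' k _ (g x) fun _ => rfl).1 i h1).symm
    · exact overwrite_of_mem_block hm'mono hkm hBm he x h1 hi
  -- sequences along which the averages are close to the means from time `K` on
  let T : ℕ → Set (ℕ → Fin N) := fun K => {x | ∀ n : ℕ, K ≤ n →
    ∑ i ∈ Finset.range n, a (x i) ≤ (χ + ε) * n ∧ (χ - ε) * n ≤ ∑ i ∈ Finset.range n, a (x i) ∧
    ∑ i ∈ Finset.range n, b (x i) ≤ (β + ε) * n ∧
    (h - ε) * n ≤ ∑ i ∈ Finset.range n, c (x i) ∧ ∑ i ∈ Finset.range n, c (x i) ≤ (h + ε) * n}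
  obtain ⟨K, hTK⟩ : ∃ K, bernoulliMeasure ρ (T K) ≠ 0 := by
    have h1 := ae_eventually_sum_lt hρ hρsum a (c := χ + ε) (by rw [hχ]; linarith)
    have h2 := ae_eventually_sum_lt hρ hρsum (fun i => -a i) (c := -(χ - ε)) (by
      have : ∑ i, ρ i * -a i = -χ := by
        rw [← hχ, ← Finset.sum_neg_distrib]
        exact Finset.sum_congr rfl fun i _ => mul_neg _ _
      linarith)
    have h3 := ae_eventually_sum_lt hρ hρsum b (c := β + ε) (by rw [hβ]; linarith)
    have h4 := ae_eventually_sum_lt hρ hρsum c (c := h + ε) (by rw [hh]; linarith)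
    have h5 := ae_eventually_sum_lt hρ hρsum (fun i => -c i) (c := -(h - ε)) (by
      have : ∑ i, ρ i * -c i = -h := by
        rw [← hh, ← Finset.sum_neg_distrib]
        exact Finset.sum_congr rfl fun i _ => mul_neg _ _
      linarith)
    by_contra! hcon
    have hnull := measure_iUnion_null hcon
    have hfull : ∀ᵐ x ∂bernoulliMeasure ρ, x ∈ ⋃ K, T K := by
      filter_upwards [h1, h2, h3, h4, h5] with x h1 h2 h3 h4 h5
      obtain ⟨K, hK⟩ := eventually_atTop.1 (h1.and (h2.and (h3.and (h4.and h5))))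
      refine mem_iUnion.2 ⟨K, fun n hn => ?_⟩
      obtain ⟨h1, h2, h3, h4, h5⟩ := hK n hn
      rw [Finset.sum_neg_distrib, neg_mul, neg_lt_neg_iff] at h2 h5
      exact ⟨h1.le, h2.le, h3.le, h5.le, h4.le⟩
    have h6 : bernoulliMeasure ρ univ ≤ 0 := by
      calc bernoulliMeasure ρ univ ≤ bernoulliMeasure ρ (⋃ K, T K) +
            bernoulliMeasure ρ (⋃ K, T K)ᶜ := by
            rw [← union_compl_self (⋃ K, T K)]; exact measure_union_le _ _
        _ = 0 := by rw [hnull, show bernoulliMeasure ρ (⋃ K, T K)ᶜ = 0 from hfull, add_zero]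
    simp at h6
  -- from stage `K` on, all overwritten prefixes are admissible for extension
  have hadm : ∀ x ∈ T K, ∀ k, K ≤ k →
      ∑ i ∈ Finset.Ico (m' k) (B k), a (g x i) ≤ (χ + ε) * (B k - m' k) ∧
          ∃ n ≥ k, g x ∈ V n := by
    intro x hx k hk
    have h1 := sum_range_le_add_sum_Ico (fun i => (hM (g x i)).2.1) (hEm k)
    have h2 : ∑ i ∈ Finset.Ico (E k) (m' k), b (g x i) ≤ ∑ i ∈ Finset.range (m' k), b (x i) := by
      rw [Finset.sum_congr rfl fun i hi => by
        rw [hgZ x i (hgap k i (Finset.mem_Ico.1 hi).1 (Finset.mem_Ico.1 hi).2)]]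
      exact Finset.sum_le_sum_of_subset_of_nonneg
        (fun i hi => Finset.mem_range.2 (Finset.mem_Ico.1 hi).2) fun i _ _ => hb _
    have h3 := (hx (m' k) (hk.trans (hkm k))).2.2.1
    have h4 := hnε (E k) k
    change _ ≤ ε * ((m' k : ℕ) : ℝ) at h4
    obtain ⟨h5, n, hn, h6⟩ := (he' k _ (g x) fun _ => rfl).2 (by linarith)
    refine ⟨?_, n, hn, h6 (hgcyl x k)⟩
    rwa [Finset.sum_congr rfl fun i hi => by rw [hgcyl x k i (Finset.mem_Ico.1 hi).2]]
  let C₀ : ℝ := h + t * (M * m' K)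
  have hbound : ∀ x ∈ T K, ∀ n : ℕ, t * ∑ i ∈ Finset.range n, a (g x i) - C₀ ≤
      ∑ i ∈ (Finset.range n).filter (· ∉ Z), c (g x i) := by
    intro x hx
    have hstep : ∀ k, K ≤ k → ∀ n ≤ m' k, t * ∑ i ∈ Finset.range n, a (g x i) - C₀ ≤
        ∑ i ∈ (Finset.range n).filter (· ∉ Z), c (g x i) := by
      intro k hk
      induction k, hk using Nat.le_induction with
      | base =>
        intro n hn
        have h1 : ∑ i ∈ Finset.range n, a (g x i) ≤ M * m' K := by
          calc ∑ i ∈ Finset.range n, a (g x i) ≤ n • M := by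
                simpa using Finset.sum_le_card_nsmul (Finset.range n) (fun i => a (g x i)) M
                  fun i _ => (hM _).1
            _ = M * n := by rw [nsmul_eq_mul, mul_comm]
            _ ≤ M * m' K := by gcongr
        have h2 : 0 ≤ ∑ i ∈ (Finset.range n).filter (· ∉ Z), c (g x i) :=
          Finset.sum_nonneg fun _ _ => hc0 _
        have h3 := mul_le_mul_of_nonneg_left h1 ht.le
        simp only [C₀]
        linarith
      | succ k hk ih =>
        intro n hn
        rcases le_total n (m' k) with h1 | h1
        · exact ih n h1
        -- inside a block only the contraction rate grows: pass to the end of the block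
        set n' := max n (B k) with hn'
        have hKn : ∀ j, m' k ≤ j → K ≤ j := fun j hj => hk.trans ((hkm k).trans hj)
        have hn'm : n' ≤ m' (k + 1) := max_le hn (hBm k)
        have hmain := mul_sum_sub_le_sum_of_block (Z := Z) (y := g x) (l := E k) hc0
          (fun i => (hM i).1) (fun i => (hM i).2.2) ha0 ht.le hh0 hε.le hκ0 hcond
          (hEm k) (hmB k) (le_max_right n (B k))
          (fun i h2 h3 => ⟨hgap k i h2 h3, hgZ x i (hgap k i h2 h3)⟩)
          (fun i h2 h3 => ⟨hgap (k + 1) i h2 (h3.trans_le hn'm),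
            hgZ x i (hgap (k + 1) i h2 (h3.trans_le hn'm))⟩)
          (hx (m' k) (hKn _ le_rfl)).1 (hx n' (hKn _ (h1.trans (le_max_left _ _)))).1
          (hx (B k) (hKn _ (hmB k))).2.1 (hx (m' k) (hKn _ le_rfl)).2.2.2.1
          (hx n' (hKn _ (h1.trans (le_max_left _ _)))).2.2.2.1
          (hx (B k) (hKn _ (hmB k))).2.2.2.2 (hnε (E k) k) (hadm x hx k hk).1 (hmκ _)
        have h2 : (Finset.range n').filter (· ∉ Z) = (Finset.range n).filter (· ∉ Z) := by
          ext i
          simp only [Finset.mem_filter, Finset.mem_range, hn', lt_max_iff]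
          refine ⟨fun ⟨h3, h4⟩ => ⟨?_, h4⟩, fun h3 => ⟨Or.inl h3.1, h3.2⟩⟩
          by_contra h5
          exact h4 ⟨k, h1.trans (not_lt.1 h5), h3.resolve_left h5⟩
        have h3 : ∑ i ∈ Finset.range n, a (g x i) ≤ ∑ i ∈ Finset.range n', a (g x i) :=
          Finset.sum_le_sum_of_subset_of_nonneg (Finset.range_mono (le_max_left _ _))
            fun i _ _ => ha0 _
        have h4 := mul_le_mul_of_nonneg_left h3 ht.le
        rw [h2] at hmain
        have h5 : 0 ≤ t * (M * m' K) := by positivity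
        simp only [C₀]
        linarith
    exact fun n => hstep (max n K) (le_max_right _ _) n ((le_max_left _ _).trans (hkm _))
  let μ : Measure (ℕ → Fin N) := ((bernoulliMeasure ρ).restrict (T K)).map g
  refine hF.le_dimH_coding_image μ (C := Real.exp C₀) ht (fun v n => ?_) ?_
  · have hcyl : MeasurableSet (PiNat.cylinder v n) := (PiNat.isOpen_cylinder _ v n).measurableSet
    rw [Measure.map_apply hg hcyl, Measure.restrict_apply (hg hcyl)]
    rcases (g ⁻¹' PiNat.cylinder v n ∩ T K).eq_empty_or_nonempty with h0 | ⟨x, hxv, hxT⟩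
    · simp [h0]
    have hsub : g ⁻¹' PiNat.cylinder v n ∩ T K ⊆
        Set.pi ((Finset.range n).filter (· ∉ Z) : Finset ℕ) fun i => {v i} := by
      rintro x ⟨hx, -⟩ i hi
      have hi' := Finset.mem_filter.1 (Finset.mem_coe.1 hi)
      exact (hgZ x i hi'.2).symm.trans (hx i (Finset.mem_range.1 hi'.1))
    have hlet := isProbabilityMeasure_letterMeasure ρ (fun i => (hρ i).le) hρsum
    refine (measure_mono hsub).trans ?_
    rw [bernoulliMeasure, Measure.infinitePi_pi _ fun _ _ => measurableSet_singleton _]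
    simp only [letterMeasure_singleton]
    rw [← ENNReal.ofReal_prod_of_nonneg fun _ _ => (hρ _).le]
    refine ENNReal.ofReal_le_ofReal ?_
    have h1 : ∏ i ∈ (Finset.range n).filter (· ∉ Z), ρ (v i) =
        Real.exp (-∑ i ∈ (Finset.range n).filter (· ∉ Z), c (g x i)) := by
      rw [← Finset.sum_neg_distrib, Real.exp_sum]
      refine Finset.prod_congr rfl fun i hi => ?_
      rw [hxv i (Finset.mem_range.1 (Finset.mem_filter.1 hi).1), neg_neg, Real.exp_log (hρ _)]
    have h2 : ∏ i ∈ Finset.range n, F.ratio (v i) =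
        Real.exp (-∑ i ∈ Finset.range n, a (g x i)) := by
      rw [← Finset.sum_neg_distrib, Real.exp_sum]
      refine Finset.prod_congr rfl fun i hi => ?_
      rw [hxv i (Finset.mem_range.1 hi), neg_neg, Real.exp_log (F.ratio_pos _)]
    rw [h1, h2, ← Real.exp_mul, ← Real.exp_add]
    exact Real.exp_le_exp.2 (by linarith [hbound x hxT n])
  · have hsub : T K ⊆ g ⁻¹' {ω | ∃ᶠ n in atTop, ω ∈ V n} := by
      intro x hx
      refine frequently_atTop.2 fun k => ?_
      obtain ⟨n, hn, hV⟩ := (hadm x hx (max k K) (le_max_right _ _)).2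
      exact ⟨n, (le_max_left _ _).trans hn, hV⟩
    intro h0
    apply hTK
    refine le_antisymm ?_ bot_le
    calc bernoulliMeasure ρ (T K) = (bernoulliMeasure ρ).restrict (T K) (T K) := by
          rw [Measure.restrict_apply_self]
      _ ≤ (bernoulliMeasure ρ).restrict (T K) (g ⁻¹' {ω | ∃ᶠ n in atTop, ω ∈ V n}) :=
          measure_mono hsub
      _ ≤ μ {ω | ∃ᶠ n in atTop, ω ∈ V n} := Measure.le_map_apply hg.aemeasurable _
      _ = 0 := h0

end SimilarityIFS

/-! ### The lower bound for the dimension -/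

section Extension

variable {N : ℕ}

theorem prod_eq_exp_neg_sum {p : Fin N → ℝ} (hp : ∀ i, 0 < p i) {ι : Type*} (s : Finset ι)
    (w : ι → Fin N) : ∏ i ∈ s, p (w i) = Real.exp (-∑ i ∈ s, -Real.log (p (w i))) := by
  rw [← Finset.sum_neg_distrib, Real.exp_sum]
  exact Finset.prod_congr rfl fun i _ => by rw [neg_neg, Real.exp_log (hp _)]

/-- The `p`-mass of a set of words that is typical for `ρ`, bounded below by a change of measure. -/
theorem eventually_le_wordMass_typical {p ρ : Fin N → ℝ} (hp : ∀ i, 0 < p i) (hρ : ∀ i, 0 < ρ i)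
    (hρsum : ∑ i, ρ i = 1) {a : Fin N → ℝ} {χ β h ε : ℝ} (hχ : ∑ i, ρ i * a i = χ)
    (hβ : ∑ i, ρ i * -Real.log (p i) = β) (hh : ∑ i, ρ i * -Real.log (ρ i) = h) (hε : 0 < ε) :
    ∀ᶠ r : ℕ in atTop, Real.exp ((h - β - 2 * ε) * r) / 2 ≤
      wordMass p ({w | ∑ i, a (w i) ≤ (χ + ε) * r} : Finset (Fin r → Fin N)) := by
  classical
  obtain ⟨η₁, h10, h11, H1⟩ := exists_wordMass_le_pow hρ hρsum a (c := χ + ε)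
    (by rw [hχ]; linarith)
  obtain ⟨η₂, h20, h21, H2⟩ := exists_wordMass_le_pow hρ hρsum (fun i => -Real.log (p i))
    (c := β + ε) (by rw [hβ]; linarith)
  obtain ⟨η₃, h30, h31, H3⟩ := exists_wordMass_le_pow hρ hρsum (fun i => Real.log (ρ i))
    (c := -h + ε) (by
      have : ∑ i, ρ i * Real.log (ρ i) = -h := by simp [← hh]
      linarith)
  have hpow : ∀ η : ℝ, 0 < η → η < 1 → ∀ᶠ r : ℕ in atTop, η ^ r ≤ 1 / 8 := fun η h0 h1 =>
    (tendsto_pow_atTop_nhds_zero_of_lt_one h0.le h1).eventually (ge_mem_nhds (by norm_num))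
  filter_upwards [hpow η₁ h10 h11, hpow η₂ h20 h21, hpow η₃ h30 h31] with r hr1 hr2 hr3
  let S₁ : Finset (Fin r → Fin N) := {w | (χ + ε) * r ≤ ∑ i, a (w i)}
  let S₂ : Finset (Fin r → Fin N) := {w | (β + ε) * r ≤ ∑ i, -Real.log (p (w i))}
  let S₃ : Finset (Fin r → Fin N) := {w | (-h + ε) * r ≤ ∑ i, Real.log (ρ (w i))}
  have hS1 : wordMass ρ S₁ ≤ 1 / 8 := (H1 r S₁ fun w hw => (Finset.mem_filter.1 hw).2).trans hr1
  have hS2 : wordMass ρ S₂ ≤ 1 / 8 := (H2 r S₂ fun w hw => (Finset.mem_filter.1 hw).2).trans hr2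
  have hS3 : wordMass ρ S₃ ≤ 1 / 8 := (H3 r S₃ fun w hw => (Finset.mem_filter.1 hw).2).trans hr3
  have hunion : ∀ A B : Finset (Fin r → Fin N),
      wordMass ρ (A ∪ B) ≤ wordMass ρ A + wordMass ρ B := fun A B => by
    have := Finset.sum_union_inter (s₁ := A) (s₂ := B) (f := fun w : Fin r → Fin N => ∏ i, ρ (w i))
    have h0 : 0 ≤ wordMass ρ (A ∩ B) := wordMass_nonneg hρ _
    simp only [wordMass] at *
    linarith
  have hgood : 1 / 2 ≤ wordMass ρ (S₁ ∪ S₂ ∪ S₃)ᶜ := by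
    rw [wordMass_compl hρsum]
    linarith [hunion (S₁ ∪ S₂) S₃, hunion S₁ S₂]
  calc Real.exp ((h - β - 2 * ε) * r) / 2
      ≤ Real.exp ((h - β - 2 * ε) * r) * wordMass ρ (S₁ ∪ S₂ ∪ S₃)ᶜ := by
        rw [div_eq_mul_one_div]; gcongr
    _ ≤ wordMass p (S₁ ∪ S₂ ∪ S₃)ᶜ := by
        rw [wordMass, wordMass, Finset.mul_sum]
        refine Finset.sum_le_sum fun w hw => ?_
        simp only [Finset.mem_compl, Finset.mem_union, not_or, S₁, S₂, S₃, Finset.mem_filter,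
          Finset.mem_univ, true_and, not_le] at hw
        rw [prod_eq_exp_neg_sum hp, prod_eq_exp_neg_sum hρ, ← Real.exp_add]
        refine Real.exp_le_exp.2 ?_
        have h1 := hw.1.2
        have h2 := hw.2
        simp only [Finset.sum_neg_distrib] at h1 ⊢
        nlinarith
    _ ≤ _ := by
        refine Finset.sum_le_sum_of_subset_of_nonneg (fun w hw => ?_)
          fun w _ _ => Finset.prod_nonneg fun _ _ => (hp _).le
        simp only [Finset.mem_compl, Finset.mem_union, not_or, S₁, Finset.mem_filter,
          Finset.mem_univ, true_and, not_le] at hw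
        exact Finset.mem_filter.2 ⟨Finset.mem_univ _, hw.1.1.le⟩

/-- The words of length `L = m + r` that extend `v` by a word of `T`. -/
def extensions {L m r : ℕ} (h : L = m + r) (v : Fin m → Fin N) (T : Finset (Fin r → Fin N)) :
    Finset (Fin L → Fin N) :=
  T.image fun e => Fin.append v e ∘ Fin.cast h

theorem wordMass_extensions (p : Fin N → ℝ) {L m r : ℕ} (h : L = m + r) (v : Fin m → Fin N)
    (T : Finset (Fin r → Fin N)) :
    wordMass p (extensions h v T) = (∏ i, p (v i)) * wordMass p T := by
  subst h
  rw [extensions, wordMass, Finset.sum_image, wordMass, Finset.mul_sum]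
  · refine Finset.sum_congr rfl fun e _ => ?_
    simp [Fin.prod_univ_add]
  · intro e _ e' _ hee
    funext j
    have := congrFun hee (Fin.natAdd m j)
    simpa using this

theorem exists_of_subword_mem_extensions {L m r : ℕ} (h : L = m + r) {v : Fin m → Fin N}
    {T : Finset (Fin r → Fin N)} {n : ℕ} {o : ℕ → Fin N} (ho : subword n L o ∈ extensions h v T) :
    (∀ i : Fin m, o (n + i) = v i) ∧ (fun j : Fin r => o (n + (m + j))) ∈ T := by
  subst h
  obtain ⟨e, he, heq⟩ := Finset.mem_image.1 ho
  refine ⟨fun i => ?_, ?_⟩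
  · have := congrFun heq (Fin.castAdd r i)
    simpa [subword] using this.symm
  · convert he using 1
    funext j
    have := congrFun heq (Fin.natAdd m j)
    simpa [subword] using this.symm

end Extension

namespace SimilarityIFS

variable {d N : ℕ}

/-- The lower bound for the dimension. Let `ρ` be a probability vector with entropy `h` and
Lyapunov exponent `χ`, and let `β = -∑ ρ_i log p_i`. A word of length `L` typical for `ρ` occurs
before time `exp (α L)` with probability about `exp (-(β - α) L)` if `β ≥ α`; a prefix of length
`(1 - κ) L` with `κ = (β - α)⁺ / h` always extends to such a word. -/
theorem OpenSetCondition.ae_le_dimH_coveringSet {F : SimilarityIFS d N} (hF : F.OpenSetCondition)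
    {p ρ : Fin N → ℝ} (hp : ∀ i, 0 < p i) (hsum : ∑ i, p i = 1) (hρ : ∀ i, 0 < ρ i)
    (hρsum : ∑ i, ρ i = 1) {α : ℝ} (hα : 0 < α) {ℓ : ℕ → ℕ} (hmono : Monotone ℓ)
    (hℓ : liminf (fun n : ℕ => (((ℓ n : ℝ) / Real.log (n : ℝ) : ℝ) : EReal)) atTop
      = ((1 / α : ℝ) : EReal)) {s t χ β h : ℝ}
    (hχ : ∑ i, ρ i * -Real.log (F.ratio i) = χ) (hβ : ∑ i, ρ i * -Real.log (p i) = β)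
    (hh : ∑ i, ρ i * -Real.log (ρ i) = h) (hs : h = s * χ + max 0 (β - α))
    (ht : 0 < t) (hts : t < s) :
    ∀ᵐ o ∂bernoulliMeasure p, ENNReal.ofReal t ≤ dimH (F.coveringSet o ℓ) := by
  classical
  have hp1 : ∀ i, p i ≤ 1 := fun i =>
    hsum ▸ Finset.single_le_sum (fun j _ => (hp j).le) (Finset.mem_univ i)
  have hN : Nonempty (Fin N) := by
    by_contra hcon
    rw [not_nonempty_iff] at hcon
    simp at hsum
  have hχ0 : 0 < χ := hχ ▸ Finset.sum_pos (fun i _ => mul_pos (hρ i)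
    (neg_pos.2 (Real.log_neg (F.ratio_pos i) (F.ratio_lt_one i)))) Finset.univ_nonempty
  set δ := max 0 (β - α) with hδ
  have hδ0 : 0 ≤ δ := le_max_left _ _
  have hδβ : β - α ≤ δ := le_max_right _ _
  have hs0 : 0 < s := ht.trans hts
  have hh0 : 0 < h := by rw [hs]; positivity
  set ε := (s - t) * χ / (9 + 4 * t) with hε
  have hst : 0 < s - t := sub_pos.2 hts
  have hε0 : 0 < ε := by positivity
  have hεeq : (9 + 4 * t) * ε = (s - t) * χ := by
    rw [hε]; field_simp
  set κ := (δ + 5 * ε) / h with hκ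
  have hκ0 : 0 < κ := by positivity
  have hhκ : h * κ = δ + 5 * ε := by rw [hκ]; field_simp
  have hcond : h * κ + 4 * ε + t * (χ + 4 * ε) ≤ h := by
    rw [hhκ, hs]; linarith
  have hκ1 : κ < 1 := by
    rw [hκ, div_lt_one hh0, ← hhκ]
    have : 0 < t * (χ + 4 * ε) := by positivity
    linarith
  let r : ℕ → ℕ := fun L => ⌈κ * L⌉₊
  let m : ℕ → ℕ := fun L => L - r L
  have hrL : ∀ L, r L ≤ L := fun L => Nat.ceil_le.2
    (mul_le_of_le_one_left (Nat.cast_nonneg L) hκ1.le)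
  have hmr : ∀ L, L = m L + r L := fun L => (Nat.sub_add_cancel (hrL L)).symm
  have hr1 : ∀ L : ℕ, κ * L ≤ r L := fun L => Nat.le_ceil _
  have hr2 : ∀ L : ℕ, (r L : ℝ) ≤ κ * L + 1 := fun L => (Nat.ceil_lt_add_one (by positivity)).le
  have hmrR : ∀ L : ℕ, (L : ℝ) = m L + r L := fun L => by exact_mod_cast hmr L
  have hrt : Tendsto r atTop atTop := tendsto_natCast_atTop_iff (R := ℝ).1
    (tendsto_atTop_mono hr1 (tendsto_natCast_atTop_atTop.const_mul_atTop hκ0))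
  have hmt : Tendsto m atTop atTop := by
    refine tendsto_natCast_atTop_iff (R := ℝ).1 (tendsto_atTop_mono (fun L => ?_)
      (tendsto_atTop_add_const_right _ (-1)
        (tendsto_natCast_atTop_atTop.const_mul_atTop (sub_pos.2 hκ1))))
    linarith [hmrR L, hr2 L]
  let T : (r : ℕ) → Finset (Fin r → Fin N) := fun r =>
    {w | ∑ i, -Real.log (F.ratio (w i)) ≤ (χ + ε) * r}
  let γ := α - ε
  let 𝒮 : (L : ℕ) → Finset (Finset (Fin L → Fin N)) := fun L =>
    (Finset.univ.image fun v : Fin (m L) → Fin N => extensions (hmr L) v (T (r L))).filter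
      fun S => Real.exp (-(γ * L)) ≤ wordMass p S
  have hcard : ∀ L, (𝒮 L).card ≤ N ^ L := fun L => by
    refine (Finset.card_filter_le _ _).trans (Finset.card_image_le.trans ?_)
    simp only [Finset.card_univ, Fintype.card_pi, Fintype.card_fin, Finset.prod_const]
    exact Nat.pow_le_pow_right (Fin.pos hN.some) (Nat.sub_le _ _)
  have hmass : ∀ᶠ L : ℕ in atTop, ∀ v : Fin (m L) → Fin N,
      ∑ i, -Real.log (p (v i)) ≤ (β + 2 * ε) * m L →
      Real.exp (-(γ * L)) ≤ wordMass p (extensions (hmr L) v (T (r L))) := by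
    filter_upwards [hrt.eventually (eventually_le_wordMass_typical hp hρ hρsum hχ hβ hh hε0),
      (tendsto_natCast_atTop_atTop (R := ℝ)).eventually_ge_atTop (Real.log 2 / (2 * ε))]
      with L hL1 hL2 v hv
    rw [wordMass_extensions]
    rw [div_le_iff₀ (by positivity)] at hL2
    have h1 : Real.exp (-((β + 2 * ε) * m L)) ≤ ∏ i, p (v i) := by
      rw [prod_eq_exp_neg_sum hp]
      exact Real.exp_le_exp.2 (neg_le_neg hv)
    calc Real.exp (-(γ * L))
        ≤ Real.exp (-((β + 2 * ε) * m L)) * (Real.exp ((h - β - 2 * ε) * r L) / 2) := by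
          have hhalf : ∀ x, Real.exp x / 2 = Real.exp (x - Real.log 2) := fun x => by
            rw [Real.exp_sub, Real.exp_log zero_lt_two]
          rw [hhalf, ← Real.exp_add]
          refine Real.exp_le_exp.2 ?_
          have h2 : h * (κ * L) ≤ h * r L := mul_le_mul_of_nonneg_left (hr1 L) hh0.le
          rw [← mul_assoc, hhκ] at h2
          have h3 := mul_le_mul_of_nonneg_right hδβ (Nat.cast_nonneg (α := ℝ) L)
          have h4 : (β + 2 * ε) * L = (β + 2 * ε) * m L + (β + 2 * ε) * r L := by
            rw [hmrR L]; ring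
          simp only [γ]
          linarith
      _ ≤ _ := mul_le_mul h1 hL1 (by positivity) (Finset.prod_nonneg fun _ _ => (hp _).le)
  have hlt := tendsto_atTop_of_liminf hα hℓ
  filter_upwards [ae_frequently_forall_exists_subword_mem hp hsum hα hmono hℓ
    (by simp only [γ]; linarith : γ < α) 𝒮 hcard fun L S hS => (Finset.mem_filter.1 hS).2] with o ho
  refine hF.le_dimH_coding_image_of_extension hρ hρsum
    (b := fun i => -Real.log (p i)) (fun i => neg_nonneg.2 (Real.log_nonpos (hp i).le (hp1 i)))
    hχ hβ hh ht hε0 hκ0.le hcond (m := m) (fun L => Nat.sub_le _ _) hmt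
    (fun L => by linarith [hmrR L, hr2 L]) fun K => ?_
  obtain ⟨n₁, hn₁⟩ := eventually_atTop.1 ((hlt.eventually hmass).and (hlt.eventually_ge_atTop K))
  obtain ⟨n, hn, hvisit⟩ := ho (max n₁ K)
  obtain ⟨hmassn, hKn⟩ := hn₁ n ((le_max_left _ _).trans hn)
  set L := ℓ n
  refine ⟨L, hKn, fun x hx => ?_⟩
  let v : Fin (m L) → Fin N := fun i => x i
  have hv : ∑ i, -Real.log (p (v i)) ≤ (β + 2 * ε) * m L := by
    rwa [Finset.sum_range] at hx
  obtain ⟨k, hk, hkn, hmem⟩ := hvisit _ (Finset.mem_filter.2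
    ⟨Finset.mem_image_of_mem _ (Finset.mem_univ v), hmassn v hv⟩)
  obtain ⟨h1, h2⟩ := exists_of_subword_mem_extensions (hmr L) hmem
  refine ⟨leftShift^[k] o, ?_, ?_, k, (le_max_right _ _).trans hk, PiNat.cylinder_anti _ hkn⟩
  · rw [leftShift_iterate]
    exact fun i hi => h1 ⟨i, hi⟩
  · rw [leftShift_iterate, Finset.sum_Ico_eq_sum_range, Finset.sum_range]
    have h3 : L - m L = r L := Nat.sub_sub_self (hrL L)
    have h4 := (Finset.mem_filter.1 h2).2
    have h5 : (L : ℝ) - m L = r L := by linarith [hmrR L]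
    rw [h5, h3]
    exact h4

/-! ### Sequences that occur in full -/

/-- A typical `o` has in its limsup set every sequence along which the letters have, on average,
mass at least `exp (-γ)` for some `γ < α`. -/
theorem _root_.ae_forall_frequently_mem_cylinder {p : Fin N → ℝ} (hp : ∀ i, 0 < p i)
    (hsum : ∑ i, p i = 1) {α : ℝ} (hα : 0 < α) {ℓ : ℕ → ℕ} (hmono : Monotone ℓ)
    (hℓ : liminf (fun n : ℕ => (((ℓ n : ℝ) / Real.log (n : ℝ) : ℝ) : EReal)) atTop
      = ((1 / α : ℝ) : EReal)) {γ : ℝ} (hγ : γ < α) :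
    ∀ᵐ o ∂bernoulliMeasure p, ∀ ω : ℕ → Fin N,
      (∀ᶠ L : ℕ in atTop, ∑ i ∈ Finset.range L, -Real.log (p (ω i)) ≤ γ * L) →
      ∃ᶠ n in atTop, ω ∈ PiNat.cylinder (leftShift^[n] o) (ℓ n) := by
  classical
  let 𝒮 : (L : ℕ) → Finset (Finset (Fin L → Fin N)) := fun L =>
    (Finset.univ.image fun w : Fin L → Fin N => {w}).filter
      fun S => Real.exp (-(γ * L)) ≤ wordMass p S
  have hcard : ∀ L, (𝒮 L).card ≤ N ^ L := fun L => by
    refine (Finset.card_filter_le _ _).trans (Finset.card_image_le.trans ?_)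
    simp
  filter_upwards [ae_frequently_forall_exists_subword_mem hp hsum hα hmono hℓ hγ 𝒮 hcard
    fun L S hS => (Finset.mem_filter.1 hS).2] with o ho ω hω
  refine frequently_atTop.2 fun K => ?_
  obtain ⟨n₁, hn₁⟩ := eventually_atTop.1 ((tendsto_atTop_of_liminf hα hℓ).eventually hω)
  obtain ⟨n, hn, hvisit⟩ := ho (max n₁ K)
  have h1 := hn₁ n ((le_max_left _ _).trans hn)
  obtain ⟨k, hk, hkn, hmem⟩ := hvisit {fun i : Fin (ℓ n) => ω i} (Finset.mem_filter.2
    ⟨Finset.mem_image_of_mem (fun w : Fin (ℓ n) → Fin N => ({w} : Finset (Fin (ℓ n) → Fin N)))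
      (Finset.mem_univ _), by
      rw [wordMass, Finset.sum_singleton, prod_eq_exp_neg_sum hp]
      rw [Finset.sum_range] at h1
      exact Real.exp_le_exp.2 (neg_le_neg h1)⟩)
  exact ⟨k, (le_max_right _ _).trans hk, PiNat.cylinder_anti _ hkn
    (mem_cylinder_leftShift_iff.2 (Finset.mem_singleton.1 hmem))⟩

theorem coveringSet_subset {F : SimilarityIFS d N} {L : Set (EuclideanSpace ℝ (Fin d))}
    (hL : F.IsAttractor L) (o : ℕ → Fin N) (ℓ : ℕ → ℕ) : F.coveringSet o ℓ ⊆ L := by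
  rw [hL.eq_range_coding]
  exact image_subset_range _ _

theorem IsAttractor.ae_coveringSet_eq {F : SimilarityIFS d N}
    {Λ : Set (EuclideanSpace ℝ (Fin d))} (hΛ : F.IsAttractor Λ)
    {p : Fin N → ℝ} (hp : ∀ i, 0 < p i)
    (hsum : ∑ i, p i = 1) {α : ℝ} (hα : 0 < α) {ℓ : ℕ → ℕ} (hmono : Monotone ℓ)
    (hℓ : liminf (fun n : ℕ => (((ℓ n : ℝ) / Real.log (n : ℝ) : ℝ) : EReal)) atTop
      = ((1 / α : ℝ) : EReal)) (hmin : ∀ i, -Real.log (p i) < α) :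
    ∀ᵐ o ∂bernoulliMeasure p, F.coveringSet o ℓ = Λ := by
  have hN : Nonempty (Fin N) := by
    by_contra hcon
    rw [not_nonempty_iff] at hcon
    simp at hsum
  obtain ⟨i₀, hi₀⟩ := Finite.exists_max fun i => -Real.log (p i)
  filter_upwards [ae_forall_frequently_mem_cylinder hp hsum hα hmono hℓ (hmin i₀)] with o ho
  refine Subset.antisymm (coveringSet_subset hΛ o ℓ) ?_
  rw [hΛ.eq_range_coding]
  rintro _ ⟨ω, rfl⟩
  refine ⟨ω, ho ω (Eventually.of_forall fun L => ?_), rfl⟩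
  refine (Finset.sum_le_card_nsmul _ _ _ fun i _ => hi₀ (ω i)).trans_eq ?_
  simp [mul_comm]

/-- If `α` exceeds the mean of `-log p` for the weights `λ_i ^ s`, the sequences that may be missing
have large averages of `-log p` infinitely often; they form a `μH[s]`-null set by the Chernoff
bound. -/
theorem IsAttractor.ae_hausdorffMeasure_coveringSet_eq {F : SimilarityIFS d N}
    {Λ : Set (EuclideanSpace ℝ (Fin d))} (hΛ : F.IsAttractor Λ) {s : ℝ} (hs0 : 0 ≤ s)
    (hs : ∑ i, F.ratio i ^ s = 1) {p : Fin N → ℝ} (hp : ∀ i, 0 < p i)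
    (hsum : ∑ i, p i = 1) {α : ℝ} (hα : 0 < α) {ℓ : ℕ → ℕ} (hmono : Monotone ℓ)
    (hℓ : liminf (fun n : ℕ => (((ℓ n : ℝ) / Real.log (n : ℝ) : ℝ) : EReal)) atTop
      = ((1 / α : ℝ) : EReal)) (hlt : ∑ i, F.ratio i ^ s * -Real.log (p i) < α) :
    ∀ᵐ o ∂bernoulliMeasure p, μH[s] (F.coveringSet o ℓ) = μH[s] Λ := by
  classical
  obtain ⟨γ, hγ, hγα⟩ := exists_between hlt
  have hν : ∀ i, 0 < F.ratio i ^ s := fun i => Real.rpow_pos_of_pos (F.ratio_pos i) s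
  obtain ⟨η, hη0, hη1, hη⟩ := exists_wordMass_le_pow hν hs (fun i => -Real.log (p i)) hγ
  let V : (L : ℕ) → Finset (Fin L → Fin N) := fun L => {w | γ * L ≤ ∑ i, -Real.log (p (w i))}
  have hnull := F.hausdorffMeasure_coding_image_frequently (fun L => (V L : Set (Fin L → Fin N)))
    hs0 (by
      refine ne_top_of_le_ne_top
        (summable_geometric_of_lt_one hη0.le hη1).tsum_ofReal_ne_top
        (ENNReal.tsum_le_tsum fun L => ?_)
      rw [Finset.tsum_subtype' (V L) fun w => ENNReal.ofReal (∏ i, F.ratio (w i) ^ s),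
        ← ENNReal.ofReal_sum_of_nonneg fun w _ => Finset.prod_nonneg fun i _ => (hν _).le]
      exact ENNReal.ofReal_le_ofReal (hη L (V L) fun w hw => (Finset.mem_filter.1 hw).2))
  filter_upwards [ae_forall_frequently_mem_cylinder hp hsum hα hmono hℓ hγα] with o ho
  refine le_antisymm (measure_mono (coveringSet_subset hΛ o ℓ)) ?_
  have hsub : Λ ⊆ F.coveringSet o ℓ ∪
      F.coding '' {ω | ∃ᶠ L in atTop, (fun i : Fin L => ω i) ∈ (V L : Set (Fin L → Fin N))} := by
    rw [hΛ.eq_range_coding]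
    rintro _ ⟨ω, rfl⟩
    by_cases hω : ∀ᶠ L : ℕ in atTop, ∑ i ∈ Finset.range L, -Real.log (p (ω i)) ≤ γ * L
    · exact Or.inl ⟨ω, ho ω hω, rfl⟩
    · refine Or.inr ⟨ω, (not_eventually.1 hω).mono fun L hL => ?_, rfl⟩
      rw [not_le, Finset.sum_range] at hL
      exact Finset.mem_coe.2 (Finset.mem_filter.2 ⟨Finset.mem_univ _, hL.le⟩)
  calc μH[s] Λ ≤ μH[s] (F.coveringSet o ℓ) + μH[s] (F.coding '' {ω | ∃ᶠ L in atTop,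
        (fun i : Fin L => ω i) ∈ (V L : Set (Fin L → Fin N))}) :=
        (measure_mono hsub).trans (measure_union_le _ _)
    _ = μH[s] (F.coveringSet o ℓ) := by rw [hnull, add_zero]

/-! ### A point that is not covered -/

/-- Long repetitions of a rare letter `i` do not occur early enough, and the fixed point of `f_i`
has no other coding. -/
theorem OpenSetCondition.ae_coveringSet_ne {F : SimilarityIFS d N} (hF : F.OpenSetCondition)
    {Λ : Set (EuclideanSpace ℝ (Fin d))} (hΛ : F.IsAttractor Λ)
    {p : Fin N → ℝ} (hp : ∀ i, 0 < p i)
    (hsum : ∑ i, p i = 1) {α : ℝ} (hα : 0 < α) {ℓ : ℕ → ℕ}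
    (hℓ : liminf (fun n : ℕ => (((ℓ n : ℝ) / Real.log (n : ℝ) : ℝ) : EReal)) atTop
      = ((1 / α : ℝ) : EReal)) {i : Fin N} (hi : α < -Real.log (p i)) :
    ∀ᵐ o ∂bernoulliMeasure p, F.coveringSet o ℓ ≠ Λ := by
  classical
  obtain ⟨a, hαa, hai⟩ := exists_between hi
  have ha : 0 < a := hα.trans hαa
  obtain ⟨n₁, hn₁⟩ := eventually_atTop.1 (eventually_log_lt_of_liminf hα hℓ hαa)
  let bad : ℕ → Set (ℕ → Fin N) := fun n =>
    {o | (n₁ ≤ n ∧ 1 ≤ n) ∧ subword n (ℓ n) o ∈ ({fun _ => i} : Finset (Fin (ℓ n) → Fin N))}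
  have hbad : ∀ n, bernoulliMeasure p (bad n) ≤
      ENNReal.ofReal (1 / (n : ℝ) ^ (-Real.log (p i) / a)) := by
    intro n
    by_cases hn : n₁ ≤ n ∧ 1 ≤ n
    swap
    · have : bad n = ∅ := by ext o; simp [bad, hn]
      simp [this]
    have hn0 : (0 : ℝ) < n := by exact_mod_cast hn.2
    have hsub : bad n ⊆
        {o | subword n (ℓ n) o ∈ ({fun _ => i} : Finset (Fin (ℓ n) → Fin N))} := fun o ho => ho.2
    refine (measure_mono hsub).trans
      ((bernoulliMeasure_subword_mem hp hsum n _).le.trans (ENNReal.ofReal_le_ofReal ?_))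
    rw [wordMass, Finset.sum_singleton, prod_eq_exp_neg_sum hp, one_div, ← Real.rpow_neg hn0.le,
      Real.rpow_def_of_pos hn0]
    refine Real.exp_le_exp.2 ?_
    have h1 := hn₁ n hn.1
    have h2 : Real.log n / a ≤ ℓ n := by rw [div_le_iff₀ ha]; linarith
    have h3 := mul_le_mul_of_nonneg_left h2 (ha.trans hai).le
    have h4 : Real.log n * -(-Real.log (p i) / a) = -(-Real.log (p i) * (Real.log n / a)) := by
      ring
    rw [h4]
    simp only [Finset.sum_const, Finset.card_univ, Fintype.card_fin, nsmul_eq_mul]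
    linarith
  have hne : ∑' n, bernoulliMeasure p (bad n) ≠ ⊤ :=
    ne_top_of_le_ne_top (Real.summable_one_div_nat_rpow.2
      ((one_lt_div ha).2 hai)).tsum_ofReal_ne_top (ENNReal.tsum_le_tsum hbad)
  filter_upwards [ae_eventually_notMem hne] with o ho heq
  have hmem : F.coding (fun _ => i) ∈ F.coveringSet o ℓ := by
    rw [heq, hΛ.eq_range_coding]
    exact mem_range_self _
  obtain ⟨ω, hω, hcod⟩ := hmem
  rw [hF.eq_const_of_coding_eq hcod] at hω
  obtain ⟨n, hn, hgood, hn₁'⟩ := (Frequently.and_eventually hω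
    (ho.and (eventually_ge_atTop (max n₁ 1)))).exists
  exact hgood ⟨⟨(le_max_left _ _).trans hn₁', (le_max_right _ _).trans hn₁'⟩,
    Finset.mem_singleton.2 (mem_cylinder_leftShift_iff.1 hn)⟩

/-! ### The dimension of the attractor -/

theorem OpenSetCondition.dimH_attractor {F : SimilarityIFS d N} (hF : F.OpenSetCondition)
    {Λ : Set (EuclideanSpace ℝ (Fin d))} (hΛ : F.IsAttractor Λ) {s : ℝ} (hs0 : 0 ≤ s)
    (hs : ∑ i, F.ratio i ^ s = 1) : dimH Λ = ENNReal.ofReal s := by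
  classical
  have hν : ∀ i, 0 < F.ratio i ^ s := fun i => Real.rpow_pos_of_pos (F.ratio_pos i) s
  have hN : Nonempty (Fin N) := by
    by_contra hcon
    rw [not_nonempty_iff] at hcon
    simp at hs
  have himage : Λ = F.coding '' univ := by rw [hΛ.eq_range_coding, image_univ]
  refine le_antisymm ?_ ?_
  · refine ENNReal.le_of_forall_pos_le_add fun ε hε _ => ?_
    have hε' : (0 : ℝ) < ε := hε
    set θ := ∑ i, F.ratio i ^ (s + ε) with hθ
    have hθ0 : 0 ≤ θ := Finset.sum_nonneg fun i _ => Real.rpow_nonneg (F.ratio_pos i).le _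
    have hθ1 : θ < 1 := by
      rw [hθ, ← hs]
      exact Finset.sum_lt_sum_of_nonempty Finset.univ_nonempty fun i _ =>
        Real.rpow_lt_rpow_of_exponent_gt (F.ratio_pos i) (F.ratio_lt_one i) (by linarith)
    have hnull := F.hausdorffMeasure_coding_image_frequently (fun L => univ)
      (by linarith : 0 ≤ s + (ε : ℝ)) (by
        refine ne_top_of_le_ne_top
          (summable_geometric_of_lt_one hθ0 hθ1).tsum_ofReal_ne_top
          (ENNReal.tsum_le_tsum fun L => ?_)
        rw [tsum_univ fun w : Fin L → Fin N => ENNReal.ofReal (∏ i, F.ratio (w i) ^ (s + (ε : ℝ))),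
          tsum_fintype, ← ENNReal.ofReal_sum_of_nonneg fun w _ => Finset.prod_nonneg fun i _ =>
            Real.rpow_nonneg (F.ratio_pos _).le _, sum_prod_word fun i => F.ratio i ^ (s + (ε : ℝ))])
    have h0 : μH[((s.toNNReal + ε : NNReal) : ℝ)] Λ = 0 := by
      rw [NNReal.coe_add, Real.coe_toNNReal s hs0, himage]
      simpa [atTop_neBot] using hnull
    have := dimH_le_of_hausdorffMeasure_ne_top (s := Λ) (d := s.toNNReal + ε) (by rw [h0]; simp)
    simpa [ENNReal.ofReal] using this
  · rcases hs0.eq_or_lt with h | h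
    · simp [← h]
    · have hprob := isProbabilityMeasure_bernoulliMeasure hν hs
      have hlet := isProbabilityMeasure_letterMeasure _ (fun i => (hν i).le) hs
      rw [himage]
      refine hF.le_dimH_coding_image (bernoulliMeasure fun i => F.ratio i ^ s) (C := 1) h
        (fun ω n => ?_) (by simp)
      rw [PiNat.cylinder_eq_pi, bernoulliMeasure,
        Measure.infinitePi_pi _ fun _ _ => measurableSet_singleton _]
      simp only [letterMeasure_singleton]
      rw [← ENNReal.ofReal_prod_of_nonneg fun _ _ => (hν _).le, one_mul,
        Real.finsetProd_rpow _ _ fun i _ => (F.ratio_pos _).le]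

end SimilarityIFS

/-! ### Conclusion -/

theorem theorem1p2 {d N : ℕ} (F : SimilarityIFS d N) (hF : F.OpenSetCondition)
    (Λ : Set (EuclideanSpace ℝ (Fin d))) (hΛ : F.IsAttractor Λ)
    (s₀ : ℝ) (hs₀ : s₀ = (dimH Λ).toReal)
    (p : Fin N → ℝ) (hp : ∀ i, 0 < p i) (hsum : ∑ i, p i = 1)
    (α : ℝ) (hα : 0 < α) (ℓ : ℕ → ℕ) (hmono : Monotone ℓ)
    (hℓ : liminf (fun n : ℕ => (((ℓ n : ℝ) / Real.log (n : ℝ) : ℝ) : EReal)) atTop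
      = ((1 / α : ℝ) : EReal)) :
    ∃ P : ℝ → ℝ,
      (∀ q t : ℝ, ∑ i, F.ratio i ^ t * (p i * Real.exp α) ^ q = 1 ↔ t = P q) ∧
      ∃ s : NNReal, IsGLB (P '' Icc 0 1) (s : ℝ) ∧
        ∀ᵐ o ∂(bernoulliMeasure p),
          dimH (F.coveringSet o ℓ) = (s : ENNReal) ∧
          ((α < -Real.log (⨅ i, p i) ∧ -∑ i, F.ratio i ^ s₀ * Real.log (p i) < α) →
            μH[s₀] (F.coveringSet o ℓ) = μH[s₀] Λ ∧ F.coveringSet o ℓ ≠ Λ) ∧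
          (-Real.log (⨅ i, p i) < α → F.coveringSet o ℓ = Λ) := by
  have hN : Nonempty (Fin N) := by
    by_contra hcon
    rw [not_nonempty_iff] at hcon
    simp at hsum
  have h0 := F.ratio_pos
  have h1 := F.ratio_lt_one
  have hu : ∀ i, 0 < p i * Real.exp α := fun i => mul_pos (hp i) (Real.exp_pos α)
  obtain ⟨P, hP⟩ := exists_pressure h0 h1 hu
  obtain ⟨q, hq, hmin⟩ := isCompact_Icc.exists_isMinOn (nonempty_Icc.2 zero_le_one)
    (continuous_pressure h0 h1 hu hP).continuousOn
  have hmin : ∀ q' ∈ Icc (0 : ℝ) 1, P q ≤ P q' := fun q' hq' => hmin hq'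
  have hPq := pressure_nonneg h0 h1 hp hsum hα hP hq
  -- the value of the pressure at `0` is the dimension of the attractor
  have hP0 : ∑ i, F.ratio i ^ P 0 = 1 := by
    simpa [pressureSum] using (hP 0 (P 0)).2 rfl
  have hP0' := pressure_nonneg h0 h1 hp hsum hα hP (left_mem_Icc.2 zero_le_one)
  have hs₀P : s₀ = P 0 := by
    rw [hs₀, hF.dimH_attractor hΛ hP0' hP0, ENNReal.toReal_ofReal hP0']
  obtain ⟨j, hj⟩ : ∃ j, p j = ⨅ i, p i := exists_eq_ciInf_of_finite
  have hpj : ∀ i, -Real.log (p i) ≤ -Real.log (⨅ i, p i) := fun i => by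
    rw [← hj]
    exact neg_le_neg (Real.log_le_log (hp j) (hj ▸ ciInf_le (Finite.bddBelow_range p) i))
  refine ⟨P, hP, ⟨P q, hPq⟩, ⟨?_, fun x hx => hx (mem_image_of_mem P hq)⟩, ?_⟩
  · rintro _ ⟨q', hq', rfl⟩
    exact hmin q' hq'
  have hupper : ∀ᵐ o ∂bernoulliMeasure p, ∀ k : ℕ,
      μH[P q + 1 / ((k : ℝ) + 1)] (F.coveringSet o ℓ) = 0 := by
    refine ae_all_iff.2 fun k => ?_
    have hk : (0 : ℝ) < 1 / ((k : ℝ) + 1) := Nat.one_div_pos_of_nat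
    exact F.ae_hausdorffMeasure_coveringSet_eq_zero hp hsum hα hℓ hq (by linarith)
      ((pressure_lt_iff h0 h1 hu hP).1 (by linarith))
  -- the equilibrium state at the minimiser
  let ρ : Fin N → ℝ := fun i => F.ratio i ^ P q * (p i * Real.exp α) ^ q
  have hρ : ∀ i, 0 < ρ i := fun i =>
    mul_pos (Real.rpow_pos_of_pos (h0 i) _) (Real.rpow_pos_of_pos (hu i) _)
  have hρsum : ∑ i, ρ i = 1 := (hP q (P q)).2 rfl
  have hentropy := entropy_eq_of_isMinOn_pressure h0 h1 hu hP hq hmin (ρ := ρ) rfl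
  have hβ : ∑ i, ρ i * -Real.log (p i * Real.exp α) = ∑ i, ρ i * -Real.log (p i) - α := by
    have : ∀ i, ρ i * -Real.log (p i * Real.exp α) = ρ i * -Real.log (p i) - ρ i * α := fun i => by
      rw [Real.log_mul (hp i).ne' (Real.exp_pos α).ne', Real.log_exp]; ring
    simp only [this, Finset.sum_sub_distrib, ← Finset.sum_mul, hρsum, one_mul]
  rw [hβ] at hentropy
  have hlower : ∀ᵐ o ∂bernoulliMeasure p, ∀ k : ℕ,
      ENNReal.ofReal (P q - 1 / ((k : ℝ) + 1)) ≤ dimH (F.coveringSet o ℓ) := by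
    refine ae_all_iff.2 fun k => ?_
    have hk : (0 : ℝ) < 1 / ((k : ℝ) + 1) := Nat.one_div_pos_of_nat
    rcases le_or_gt (P q - 1 / ((k : ℝ) + 1)) 0 with hle | hgt
    · exact Eventually.of_forall fun o => by rw [ENNReal.ofReal_of_nonpos hle]; exact bot_le
    · exact hF.ae_le_dimH_coveringSet hp hsum hρ hρsum hα hmono hℓ rfl rfl rfl hentropy hgt
        (by linarith)
  have hmeasure : -∑ i, F.ratio i ^ s₀ * Real.log (p i) < α → ∀ᵐ o ∂bernoulliMeasure p,
      μH[s₀] (F.coveringSet o ℓ) = μH[s₀] Λ := by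
    intro h
    refine hΛ.ae_hausdorffMeasure_coveringSet_eq (by rw [hs₀P]; exact hP0')
      (by rw [hs₀P]; exact hP0) hp hsum hα hmono hℓ ?_
    simpa using h
  have hne : α < -Real.log (⨅ i, p i) → ∀ᵐ o ∂bernoulliMeasure p, F.coveringSet o ℓ ≠ Λ :=
    fun h => hF.ae_coveringSet_ne hΛ hp hsum hα hℓ (i := j) (by rw [hj]; exact h)
  have hfull : -Real.log (⨅ i, p i) < α → ∀ᵐ o ∂bernoulliMeasure p, F.coveringSet o ℓ = Λ :=
    fun h => hΛ.ae_coveringSet_eq hp hsum hα hmono hℓ fun i => (hpj i).trans_lt h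
  filter_upwards [hupper, hlower, eventually_imp_distrib_left.2 hmeasure,
    eventually_imp_distrib_left.2 hne, eventually_imp_distrib_left.2 hfull]
    with o hu' hl' hm' hn' hf'
  have hlim : Tendsto (fun k : ℕ => 1 / ((k : ℝ) + 1)) atTop (𝓝 0) :=
    tendsto_one_div_add_atTop_nhds_zero_nat
  have hcoe : ENNReal.ofNNReal ⟨P q, hPq⟩ = ENNReal.ofReal (P q) :=
    (ENNReal.ofReal_eq_coe_nnreal hPq).symm
  refine ⟨?_, fun h => ⟨hm' h.2, hn' h.1⟩, hf'⟩
  rw [hcoe]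
  refine le_antisymm ?_ ?_
  · refine ge_of_tendsto' (x := atTop)
      (f := fun k : ℕ => ENNReal.ofReal (P q + 1 / ((k : ℝ) + 1))) ?_ fun k => ?_
    · simpa using ENNReal.tendsto_ofReal (hlim.const_add (P q))
    · have hk : (0 : ℝ) < 1 / ((k : ℝ) + 1) := Nat.one_div_pos_of_nat
      have hk' : 0 ≤ P q + 1 / ((k : ℝ) + 1) := by linarith
      refine dimH_le_of_hausdorffMeasure_ne_top ?_
      rw [Real.coe_toNNReal _ hk', hu' k]
      simp
  · refine le_of_tendsto' (x := atTop)
      (f := fun k : ℕ => ENNReal.ofReal (P q - 1 / ((k : ℝ) + 1))) ?_ hl'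
    simpa using ENNReal.tendsto_ofReal (hlim.const_sub (P q))
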